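/- All graphs are simple and undirected. An infinite graph $G$ is *non-amenable* if there is a constant $\gamma>0$ such that $|\partial S|\ge \gamma |S|$ for every finite vertex set $S$, where $\partial S$ is the set of vertices outside $S$ that are adjacent to a vertex of $S$. A *planar map* is a graph $G$ together with an embedding in the plane: distinct vertices are distinct points, edges are arcs between their endvertices, and an arc meets vertices and other arcs only at common endvertices. For a locally finite planar map $G$, the *roundabout graph* $\mathring{G}$ has as vertices the pairs $(v,e)$ with $e$ an edge of $G$ and $v$ an endvertex of $e$. Its edges are as follows: $(v,e)$ is joined to $(w,e)$ for each edge $e=vw$ of $G$, and $(v,e)$ is joined to $(v,f)$ whenever $e\neq f$ are adjacent in the cyclic order that the embedding induces on the edges incident with $v$. A locally finite graph is *transient* if, for every vertex $o$, simple random walk started at $o$ returns to $o$ with probability strictly less than $1$. The planar map $G$ is *UK-transient* if $\mathring{G}$ is transient. **Theorem.** Every locally finite non-amenable planar map is UK-transient. -/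

import Mathlib

open MeasureTheory ProbabilityTheory

noncomputable section

/-! ### Amenability -/

/-- The outer vertex boundary of a vertex set `S`: the vertices outside `S` that are adjacent to a
vertex of `S`. -/
def SimpleGraph.vertexBoundary {V : Type*} (G : SimpleGraph V) (S : Set V) : Set V :=
  {w | w ∉ S ∧ ∃ v ∈ S, G.Adj v w}

/-- An infinite (locally finite) graph is non-amenable if some constant `γ > 0` satisfies
`|∂S| ≥ γ |S|` for every finite set `S` of vertices. -/
def SimpleGraph.IsNonamenable {V : Type*} (G : SimpleGraph V) : Prop :=
  Infinite V ∧
    ∃ γ : ℝ, 0 < γ ∧ ∀ S : Finset V, γ * (S.card : ℝ) ≤ ((G.vertexBoundary ↑S).ncard : ℝ)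

/-! ### Simple random walk and transience -/

open Classical in
/-- The law of one step of simple random walk from `x`: uniform on the neighbours of `x`.
(If `x` has no neighbour, the walk stays at `x`; the same junk value is used
if `x` has infinitely many neighbours.) -/
def SimpleGraph.stepMeasure {V : Type*} [MeasurableSpace V] (G : SimpleGraph V) (x : V) :
    Measure V :=
  if (G.neighborSet x).Finite ∧ (G.neighborSet x).Nonempty then uniformOn (G.neighborSet x)
  else Measure.dirac x

/-- The transition kernel of simple random walk, as a function of the past trajectory
(of which it only uses the current position). -/
def SimpleGraph.stepKernel {V : Type*} [MeasurableSpace V] [DiscreteMeasurableSpace V]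
    (G : SimpleGraph V) (n : ℕ) : Kernel (Finset.Iic n → V) V where
  toFun x := G.stepMeasure (x ⟨n, Finset.mem_Iic.2 le_rfl⟩)
  measurable' := (Measurable.of_discrete (f := G.stepMeasure)).comp (measurable_pi_apply _)

instance SimpleGraph.stepKernel.instIsMarkovKernel {V : Type*} [MeasurableSpace V]
    [DiscreteMeasurableSpace V] (G : SimpleGraph V) (n : ℕ) : IsMarkovKernel (G.stepKernel n) := by
  refine ⟨fun x => ?_⟩
  change IsProbabilityMeasure (G.stepMeasure _)
  unfold SimpleGraph.stepMeasure
  split_ifs with h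
  · exact isProbabilityMeasure_uniformOn h.1 h.2
  · infer_instance

/-- The law, on the space of trajectories `ℕ → V`, of simple random walk started at `o`. -/
def SimpleGraph.walkLaw {V : Type*} [MeasurableSpace V] [DiscreteMeasurableSpace V]
    (G : SimpleGraph V) (o : V) : Measure (ℕ → V) :=
  Kernel.trajMeasure (X := fun _ => V) (Measure.dirac o) G.stepKernel

/-- The probability that simple random walk started at `o` ever returns to `o`. Vertex sets are
given the discrete `σ`-algebra. -/
def SimpleGraph.returnProb {V : Type*} (G : SimpleGraph V) (o : V) : ENNReal :=
  letI : MeasurableSpace V := ⊤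
  haveI : DiscreteMeasurableSpace V := ⟨fun _ => trivial⟩
  G.walkLaw o {ω | ∃ n, 1 ≤ n ∧ ω n = o}

/-- A locally finite graph is transient if simple random walk started at any given vertex
returns to it with probability less than one. (For connected graphs it does not matter which
vertex is considered; for disconnected ones all components are required to be transient.) -/
def SimpleGraph.IsTransient {V : Type*} (G : SimpleGraph V) : Prop :=
  ∀ o : V, G.returnProb o < 1

/-! ### Planar maps -/

/-- A planar map (plane graph): a simple graph drawn in the plane `ℂ`. Vertices are distinct
points, each edge `uv` is an arc (injective path) joining `u` to `v`, and arcs meet vertices and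
other arcs only at common endpoints. The drawing is allowed to have accumulation points. -/
structure PlanarMap (V : Type*) where
  /-- the underlying graph -/
  graph : SimpleGraph V
  /-- the position of a vertex -/
  pt : V → ℂ
  /-- the arc of an edge, parametrised from `u` to `v` -/
  arc : ∀ u v : V, graph.Adj u v → Path (pt u) (pt v)
  pt_injective : Function.Injective pt
  /-- the two orientations of an edge have the same arc, traversed in opposite directions -/
  arc_symm : ∀ (u v : V) (h : graph.Adj u v), arc v u h.symm = (arc u v h).symm
  arc_injective : ∀ (u v : V) (h : graph.Adj u v), Function.Injective (arc u v h)
  /-- an arc contains no vertices other than its endpoints -/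
  arc_vertex : ∀ (u v : V) (h : graph.Adj u v) (t : unitInterval) (w : V),
    arc u v h t = pt w → w = u ∨ w = v
  /-- arcs of distinct edges meet only in vertices -/
  arc_disjoint : ∀ (u v : V) (h : graph.Adj u v) (u' v' : V) (h' : graph.Adj u' v')
    (t t' : unitInterval), s(u, v) ≠ s(u', v') →
      arc u v h t = arc u' v' h' t' → ∃ w, arc u v h t = pt w

namespace PlanarMap

variable {V : Type*} (G : PlanarMap V)

/-- Half the distance from `v` to its nearest neighbour in the drawing. If `v` has finitely many
neighbours, but at least one, then this is positive. -/
def radius (v : V) : ℝ := Metric.infDist (G.pt v) (G.pt '' G.graph.neighborSet v) / 2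

/-- The first time at which the arc of the dart `d = (v, w)`, started at `v`, hits the circle of
radius `G.radius v` around `v`. -/
def exitTime (d : G.graph.Dart) : unitInterval :=
  sInf {t | G.radius d.fst ≤ dist (G.arc d.fst d.snd d.adj t) (G.pt d.fst)}

/-- The direction, seen from `v`, of the point where the arc of the dart `d = (v, w)` first hits
the circle of radius `G.radius v` around `v`. -/
def exitAngle (d : G.graph.Dart) : Real.Angle :=
  ((G.arc d.fst d.snd d.adj (G.exitTime d) - G.pt d.fst).arg : Real.Angle)

/-- `d'` directly follows `d` in the cyclic order induced by the drawing on the edges at their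
common start vertex `v`: no third edge at `v` lies strictly between them (counterclockwise).
The cyclic order is that of the points in which the arcs starting at `v` first hit a circle around
`v` that is small enough not to enclose the other endpoints; up to those points, the arcs are
disjoint paths in a closed disc from the centre to distinct points of the bounding circle,
so the order does not depend on the radius of the circle. -/
def IsNextAt (d d' : G.graph.Dart) : Prop :=
  d.fst = d'.fst ∧ d ≠ d' ∧
    ∀ d'' : G.graph.Dart, d''.fst = d.fst → ¬ sbtw (G.exitAngle d) (G.exitAngle d'') (G.exitAngle d')

/-- The roundabout graph. Its vertices are the pairs `(v, e)` with `e` an edge and `v` an endvertex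
of `e`; as the graph is simple, such a pair is the same as a dart, namely `e` directed away
from `v`. For each edge `e = vw`, the vertices `(v, e)` and `(w, e)` are joined, and
`(v, e)` and `(v, f)` are joined if `e` and `f` are adjacent in the cyclic order at `v`. -/
def roundabout : SimpleGraph G.graph.Dart where
  Adj d d' := d' = d.symm ∨ G.IsNextAt d d' ∨ G.IsNextAt d' d
  symm := ⟨by
    rintro d d' (h | h | h)
    · exact Or.inl (by rw [h, SimpleGraph.Dart.symm_symm])
    · exact Or.inr (Or.inr h)
    · exact Or.inr (Or.inl h)⟩
  loopless := ⟨by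
    rintro d (h | h | h)
    · exact d.symm_ne h.symm
    · exact h.2.1 rfl
    · exact h.2.1 rfl⟩

/-- A planar map is UK-transient if its roundabout graph is transient. -/
def IsUKTransient : Prop := G.roundabout.IsTransient

end PlanarMap

end

noncomputable section

/-! ### Continuous logarithms -/

/-! The roundabout graph has degrees at most 3, and it inherits a strong isoperimetric inequality
from the map; a graph with such an inequality and no isolated vertices is transient.

For the inequality (`PlanarMap.card_le_ncard_outDarts`), let `D` be a finite set of darts with `b`
boundary edges in the roundabout graph. A dart of `D` whose reverse is missing costs a boundary
edge, and so does a vertex with some but not all of its darts in `D`, because the cyclic order there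
must leave `D` somewhere. The darts of `D` with reverse in `D` are controlled by the number of edges
spanned by their endvertices, which is linear by planarity. The vertices with all darts in `D` form
a set whose boundary is accounted for by the two costs above, so non-amenability bounds their number
by a multiple of `b`.

The linear edge bound (`PlanarMap.adjPairs_le`) uses neither faces nor Euler's formula. A drawing
yields winding numbers of edges around vertices (`AngleSystem`); this structure survives contraction
of edges and cannot exist on five mutually adjacent vertices, by a parity count of crossings. On the
other hand, average degree 8 forces a `K₅` minor.

Transience follows Cheeger's argument: isoperimetry gives a Poincaré inequality, which is applied to
the Green function of the walk killed on returning to `o`. This bounds the return probability by `1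
- 1 / (8 * K ^ 2)`. -/

theorem exists_continuous_log {X : Type*} [TopologicalSpace X] [SimplyConnectedSpace X]
    [LocallyPathConnectedSpace X] {g : X → ℂ} (hg : Continuous g) (h0 : ∀ x, g x ≠ 0) :
    ∃ f : X → ℂ, Continuous f ∧ ∀ x, Complex.exp (f x) = g x := by
  obtain ⟨x₀⟩ : Nonempty X := inferInstance
  obtain ⟨F, ⟨-, hF⟩, -⟩ := Complex.isCoveringMapOn_exp.existsUnique_continuousMap_lifts
    ⟨g, hg⟩ (a₀ := x₀) (Complex.exp_log (h0 x₀)) h0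
  exact ⟨F, F.continuous, fun x => congrFun hF x⟩

/-- Both `l` and a translate of `m` lift the same path through the covering `exp`, and they agree at
`s`. Increments of a logarithm are thus insensitive to its branch and to a constant factor `c`. -/
theorem log_increment_eq {l m : ℝ → ℂ} (hl : Continuous l) (hm : Continuous m) (c : ℂ)
    (h : ∀ t, Complex.exp (l t) = c * Complex.exp (m t)) (s t : ℝ) :
    l t - l s = m t - m s := by
  have key : l = fun x => m x + (l s - m s) := by
    refine Complex.isCoveringMap_exp.eq_of_comp_eq hl (by fun_prop) ?_ s (by simp)
    funext x
    apply Subtype.ext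
    have hc : c = Complex.exp (l s) / Complex.exp (m s) := by
      rw [h s, mul_div_assoc, div_self (Complex.exp_ne_zero _), mul_one]
    simp only [Function.comp_apply, Complex.exp_add, Complex.exp_sub, h x, ← hc]
    ring
  rw [key]
  ring

/-! ### Angle systems -/

/-- The winding data of a drawing: `θ u w w'` records the increment of the logarithm of `z - u`
as `z` runs along the edge `ww'`. -/
structure AngleSystem {V : Type*} (p : V → ℂ) (H : SimpleGraph V) (θ : V → V → V → ℂ) : Prop where
  exp_eq : ∀ u v w w', H.Adj u v → H.Adj w w' → u ≠ w → u ≠ w' →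
    Complex.exp (θ u w w') * (p w - p u) = p w' - p u
  symm : ∀ u v w w', H.Adj u v → H.Adj w w' → u ≠ w → u ≠ w' → θ u w' w = -θ u w w'
  rect : ∀ u u' w w', H.Adj u u' → H.Adj w w' → u ≠ w → u ≠ w' → u' ≠ w → u' ≠ w' →
    θ u' w w' - θ u w w' = θ w' u u' - θ w u u'

theorem AngleSystem.mono {V : Type*} {p : V → ℂ} {H H' : SimpleGraph V} {θ : V → V → V → ℂ}
    (h : AngleSystem p H θ) (hle : H' ≤ H) : AngleSystem p H' θ where
  exp_eq u v w w' hu hw := h.exp_eq u v w w' (hle hu) (hle hw)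
  symm u v w w' hu hw := h.symm u v w w' (hle hu) (hle hw)
  rect u u' w w' hu hw := h.rect u u' w w' (hle hu) (hle hw)

/-- Contract the edge `xy` into its endvertex `x`; the vertex `y` becomes isolated. -/
def SimpleGraph.contractInto {V : Type*} (H : SimpleGraph V) (x y : V) : SimpleGraph V where
  Adj a b := a ≠ b ∧ a ≠ y ∧ b ≠ y ∧ (H.Adj a b ∨ (a = x ∧ H.Adj y b) ∨ (b = x ∧ H.Adj y a))
  symm := ⟨fun a b ⟨h1, h2, h3, h4⟩ => ⟨h1.symm, h3, h2, by
    rcases h4 with h | h | h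
    · exact Or.inl h.symm
    · exact Or.inr (Or.inr h)
    · exact Or.inr (Or.inl h)⟩⟩
  loopless := ⟨fun a h => h.1 rfl⟩

theorem SimpleGraph.contractInto_adj_left {V : Type*} {G : SimpleGraph V} {x y a b : V}
    (hxy : G.Adj x y) (h : (G.contractInto x y).Adj a b) : a ≠ y ∧ ∃ c, G.Adj a c := by
  obtain ⟨-, h2, -, h4 | ⟨rfl, -⟩ | ⟨-, h4⟩⟩ := h
  exacts [⟨h2, _, h4⟩, ⟨h2, _, hxy⟩, ⟨h2, _, h4.symm⟩]

-- A new edge from `x` to `b` is thought of as the old path `x, y, b`, so its angle is the sum of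
-- two old ones. Since `y` becomes isolated, requiring the viewpoint `u` to have a neighbour
-- excludes `u = y`, from which this path could not be viewed.
open Classical in
theorem AngleSystem.contractInto {V : Type*} {p : V → ℂ} {H : SimpleGraph V} {θ : V → V → V → ℂ}
    (h : AngleSystem p H θ) {x y : V} (hxy : H.Adj x y) :
    ∃ θ', AngleSystem p (H.contractInto x y) θ' := by
  have new : ∀ {a b : V}, (H.contractInto x y).Adj a b → ¬ H.Adj a b →
      (a = x ∧ H.Adj y b) ∨ (a ≠ x ∧ b = x ∧ H.Adj y a) := by
    rintro a b ⟨h1, h2, h3, h4⟩ h5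
    rcases h4 with h4 | h4 | ⟨rfl, h4⟩
    exacts [absurd h4 h5, Or.inl h4, Or.inr ⟨h1, rfl, h4⟩]
  have old : ∀ {a b : V}, (H.contractInto x y).Adj a b → a ≠ y ∧ ∃ c, H.Adj a c :=
    SimpleGraph.contractInto_adj_left hxy
  refine ⟨fun u a b => if H.Adj a b then θ u a b else if a = x then θ u x y + θ u y b
    else θ u a y + θ u y x, ?_, ?_, ?_⟩
  · intro u v w w' huv hww hu hu'
    obtain ⟨huy, c, huc⟩ := old huv
    by_cases hw : H.Adj w w'
    · simp only [hw, if_true]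
      exact h.exp_eq u c w w' huc hw hu hu'
    simp only [hw, if_false]
    rcases new hww hw with ⟨rfl, hy⟩ | ⟨hx, rfl, hy⟩
    · simp only [if_true, Complex.exp_add]
      linear_combination Complex.exp (θ u y w') * h.exp_eq u c w y huc hxy hu huy +
        h.exp_eq u c y w' huc hy huy hu'
    · simp only [hx, if_false, Complex.exp_add]
      linear_combination Complex.exp (θ u y w') * h.exp_eq u c w y huc hy.symm hu huy +
        h.exp_eq u c y w' huc hxy.symm huy hu'
  · intro u v w w' huv hww hu hu'
    obtain ⟨huy, c, huc⟩ := old huv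
    by_cases hw : H.Adj w w'
    · simp only [hw, hw.symm, if_true]
      exact h.symm u c w w' huc hw hu hu'
    have hw' : ¬ H.Adj w' w := fun h => hw h.symm
    simp only [hw, hw', if_false]
    rcases new hww hw with ⟨rfl, hy⟩ | ⟨hx, rfl, hy⟩
    · simp only [if_true, hww.1.symm, if_false]
      linear_combination h.symm u c w y huc hxy hu huy + h.symm u c y w' huc hy huy hu'
    · simp only [hx, if_false, if_true]
      linear_combination h.symm u c w y huc hy.symm hu huy + h.symm u c y w' huc hxy.symm huy hu'
  · intro u u' w w' huu hww a b c d
    have huy := (old huu).1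
    have huy' := (old huu.symm).1
    have hwy := (old hww).1
    have hwy' := (old hww.symm).1
    by_cases hu : H.Adj u u' <;> by_cases hw : H.Adj w w' <;> simp only [hu, hw, if_true, if_false]
    · exact h.rect u u' w w' hu hw a b c d
    · rcases new hww hw with ⟨rfl, hy⟩ | ⟨hx, rfl, hy⟩
      · simp only [if_true]
        linear_combination h.rect u u' w y hu hxy a huy c huy' + h.rect u u' y w' hu hy huy b huy' d
      · simp only [hx, if_false]
        linear_combination h.rect u u' w y hu hy.symm a huy c huy' +
          h.rect u u' y w' hu hxy.symm huy b huy' d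
    · rcases new huu hu with ⟨rfl, hy⟩ | ⟨hx, rfl, hy⟩
      · simp only [if_true]
        linear_combination h.rect u y w w' hxy hw a b hwy.symm hwy'.symm +
          h.rect y u' w w' hy hw hwy.symm hwy'.symm c d
      · simp only [hx, if_false]
        linear_combination h.rect u y w w' hy.symm hw a b hwy.symm hwy'.symm +
          h.rect y u' w w' hxy.symm hw hwy.symm hwy'.symm c d
    -- Two new edges both contain `x`, hence are never disjoint.
    · exfalso
      rcases new huu hu with ⟨rfl, -⟩ | ⟨-, rfl, -⟩ <;>
      rcases new hww hw with ⟨rfl, -⟩ | ⟨-, rfl, -⟩ <;> contradiction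

theorem AngleSystem.not_isNClique_five {V : Type*} {p : V → ℂ} (hp : Function.Injective p)
    {H : SimpleGraph V}
    {θ : V → V → V → ℂ} (h : AngleSystem p H θ) (f : Fin 5 → V) (hinj : Function.Injective f)
    (hf : ∀ i j, i ≠ j → H.Adj (f i) (f j)) : False := by
  have hS : ∀ i j, i ≠ j → p (f j) - p (f i) ≠ 0 := fun i j hij e =>
    hij (hinj (hp (sub_eq_zero.1 e))).symm
  -- One logarithm is fixed per unordered pair; `δ` supplies the half turn for the reversed
  -- direction. Each angle is then determined up to an integer `n` of full turns.
  set S : Fin 5 → Fin 5 → ℂ := fun i j => Complex.log (p (f (max i j)) - p (f (min i j))) with hSdef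
  set δ : Fin 5 → Fin 5 → ℤ := fun i j => if j < i then 1 else 0 with hδ
  have hSs : ∀ i j, S i j = S j i := fun i j => by simp only [hSdef, max_comm, min_comm]
  have hA : ∀ i j, i ≠ j →
      Complex.exp (S i j + δ i j * (Real.pi * Complex.I)) = p (f j) - p (f i) := by
    intro i j hij
    rcases lt_or_gt_of_ne hij with hlt | hlt
    · simp only [hSdef, hδ, max_eq_right hlt.le, min_eq_left hlt.le, not_lt.2 hlt.le, if_false]
      simp [Complex.exp_log (hS i j hij)]
    · simp only [hSdef, hδ, max_eq_left hlt.le, min_eq_right hlt.le, hlt, if_true]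
      simp [Complex.exp_add, Complex.exp_log (hS j i hij.symm)]
  have hN : ∀ u w w' : Fin 5, ∃ n : ℤ, u ≠ w → u ≠ w' → w ≠ w' → θ (f u) (f w) (f w') =
      (S u w' + δ u w' * (Real.pi * Complex.I)) - (S u w + δ u w * (Real.pi * Complex.I))
        + n * (2 * Real.pi * Complex.I) := by
    intro u w w'
    by_cases hd : u ≠ w ∧ u ≠ w' ∧ w ≠ w'
    · obtain ⟨h1, h2, h3⟩ := hd
      have e := h.exp_eq (f u) (f w) (f w) (f w') (hf u w h1) (hf w w' h3) (hinj.ne h1) (hinj.ne h2)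
      rw [← hA u w h1, ← hA u w' h2, ← Complex.exp_add, Complex.exp_eq_exp_iff_exists_int] at e
      obtain ⟨n, hn⟩ := e
      exact ⟨n, fun _ _ _ => by linear_combination hn⟩
    · exact ⟨0, fun h1 h2 h3 => absurd ⟨h1, h2, h3⟩ hd⟩
  choose n hn using hN
  have key : ∀ u u' w w' : Fin 5,
      u ≠ u' ∧ w ≠ w' ∧ u ≠ w ∧ u ≠ w' ∧ u' ≠ w ∧ u' ≠ w' →
      δ u' w' - δ u' w - δ u w' + δ u w - δ w' u' + δ w' u + δ w u' - δ w u
        + 2 * (n u' w w' - n u w w' - n w' u u' + n w u u') = 0 := by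
    rintro u u' w w' ⟨h1, h2, h3, h4, h5, h6⟩
    have e := h.rect (f u) (f u') (f w) (f w') (hf _ _ h1) (hf _ _ h2) (hinj.ne h3) (hinj.ne h4)
      (hinj.ne h5) (hinj.ne h6)
    rw [hn u' w w' h5 h6 h2, hn u w w' h3 h4 h2, hn w' u u' h4.symm h6.symm h1,
      hn w u u' h3.symm h5.symm h1, hSs w' u', hSs w' u, hSs w u', hSs w u] at e
    have hpi : (Real.pi * Complex.I : ℂ) ≠ 0 := by simp [Real.pi_ne_zero]
    have e' : ((δ u' w' - δ u' w - δ u w' + δ u w - δ w' u' + δ w' u + δ w u' - δ w u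
        + 2 * (n u' w w' - n u w w' - n w' u u' + n w u u') : ℤ) : ℂ) * (Real.pi * Complex.I) = 0 := by
      push_cast
      linear_combination e
    exact_mod_cast (mul_eq_zero.1 e').resolve_right hpi
  -- These are the fifteen pairs of disjoint edges of `K₅`. Modulo 4 the signs of the terms `2 * n`
  -- are irrelevant, and each `n` occurs in exactly two relations, so these terms cancel in the sum.
  -- The `δ` part is `±2` for interleaved pairs such as `02, 13` and `0` otherwise. Each of the five
  -- 4-subsets contains one interleaved pair, so the sum would be 10, that is 2, modulo 4.
  have k0 := key 1 2 3 4 (by decide)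
  have k1 := key 1 3 2 4 (by decide)
  have k2 := key 1 4 2 3 (by decide)
  have k3 := key 0 2 3 4 (by decide)
  have k4 := key 0 3 2 4 (by decide)
  have k5 := key 0 4 2 3 (by decide)
  have k6 := key 0 1 3 4 (by decide)
  have k7 := key 0 3 1 4 (by decide)
  have k8 := key 0 4 1 3 (by decide)
  have k9 := key 0 1 2 4 (by decide)
  have k10 := key 0 2 1 4 (by decide)
  have k11 := key 0 4 1 2 (by decide)
  have k12 := key 0 1 2 3 (by decide)
  have k13 := key 0 2 1 3 (by decide)
  have k14 := key 0 3 1 2 (by decide)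
  simp [hδ] at k0 k1 k2 k3 k4 k5 k6 k7 k8 k9 k10 k11 k12 k13 k14
  omega

/-- Disjoint edges have disjoint arcs, so the difference of their points is a nonvanishing function
of two parameters and has a continuous logarithm `L` on the plane. The relation `rect` says that the
increments of `L` around the boundary of the unit square cancel. -/
theorem PlanarMap.exists_angleSystem {V : Type*} (G : PlanarMap V) :
    ∃ θ, AngleSystem G.pt G.graph θ := by
  classical
  have hne : ∀ u w w' (hw : G.graph.Adj w w'), u ≠ w → u ≠ w' → ∀ t : ℝ,
      (G.arc w w' hw).extend t - G.pt u ≠ 0 := by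
    intro u w w' hw h1 h2 t h
    rcases G.arc_vertex w w' hw _ u (sub_eq_zero.1 h) with h | h
    exacts [h1 h, h2 h]
  have hlog : ∀ u w w', ∃ l : ℝ → ℂ, ∀ hw : G.graph.Adj w w', u ≠ w → u ≠ w' → Continuous l ∧
      ∀ t, Complex.exp (l t) = (G.arc w w' hw).extend t - G.pt u := by
    intro u w w'
    by_cases hw : G.graph.Adj w w' ∧ u ≠ w ∧ u ≠ w'
    · obtain ⟨l, hl, hl'⟩ := exists_continuous_log
        (g := fun t : ℝ => (G.arc w w' hw.1).extend t - G.pt u) (by fun_prop)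
        (hne u w w' hw.1 hw.2.1 hw.2.2)
      exact ⟨l, fun _ _ _ => ⟨hl, hl'⟩⟩
    · exact ⟨0, fun h1 h2 h3 => absurd ⟨h1, h2, h3⟩ hw⟩
  choose l hl using hlog
  refine ⟨fun u w w' => l u w w' 1 - l u w w' 0, ?_, ?_, ?_⟩
  · intro u _ w w' _ hw h1 h2
    obtain ⟨-, he⟩ := hl u w w' hw h1 h2
    have e0 := he 0
    have e1 := he 1
    rw [Path.extend_zero] at e0
    rw [Path.extend_one] at e1
    rw [← e0, ← e1, ← Complex.exp_add]
    ring_nf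
  · intro u _ w w' _ hw h1 h2
    obtain ⟨hc, he⟩ := hl u w w' hw h1 h2
    obtain ⟨hc', he'⟩ := hl u w' w hw.symm h2 h1
    have := log_increment_eq (l := l u w' w) (m := fun t => l u w w' (1 - t)) hc' (by fun_prop) 1
      (fun t => by rw [he', he, G.arc_symm w w' hw, Path.extend_symm, one_mul]) 0 1
    simp only [sub_self, sub_zero] at this
    rw [this, neg_sub]
  · intro u u' w w' hu hw h1 h2 h3 h4
    have hne2 : ∀ q : ℝ × ℝ, (G.arc w w' hw).extend q.2 - (G.arc u u' hu).extend q.1 ≠ 0 := by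
      intro q hq
      have hs : s(w, w') ≠ s(u, u') := by
        intro hs
        rcases Sym2.eq_iff.1 hs with ⟨h, -⟩ | ⟨h, -⟩
        exacts [h1 h.symm, h3 h.symm]
      obtain ⟨x, hx⟩ := G.arc_disjoint w w' hw u u' hu _ _ hs (sub_eq_zero.1 hq)
      have hx' := hx
      erw [sub_eq_zero.1 hq] at hx'
      rcases G.arc_vertex _ _ _ _ _ hx with rfl | rfl <;>
      rcases G.arc_vertex _ _ _ _ _ hx' with rfl | rfl <;> contradiction
    obtain ⟨L, hL, hL'⟩ := exists_continuous_log
      (g := fun q : ℝ × ℝ => (G.arc w w' hw).extend q.2 - (G.arc u u' hu).extend q.1)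
      (by fun_prop) hne2
    have a1 := log_increment_eq (l := l u' w w') (m := fun t => L (1, t))
      (hl u' w w' hw h3 h4).1 (by fun_prop) 1
      (fun t => by rw [(hl u' w w' hw h3 h4).2, hL']; simp) 0 1
    have a2 := log_increment_eq (l := l u w w') (m := fun t => L (0, t))
      (hl u w w' hw h1 h2).1 (by fun_prop) 1
      (fun t => by rw [(hl u w w' hw h1 h2).2, hL']; simp) 0 1
    -- Viewed from `w'`, the difference has the opposite sign to the one defining `L`, whence the
    -- factor `-1`.
    have a3 := log_increment_eq (l := l w' u u') (m := fun t => L (t, 1))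
      (hl w' u u' hu h2.symm h4.symm).1 (by fun_prop) (-1)
      (fun t => by rw [(hl w' u u' hu h2.symm h4.symm).2, hL']; simp) 0 1
    have a4 := log_increment_eq (l := l w u u') (m := fun t => L (t, 0))
      (hl w u u' hu h1.symm h3.symm).1 (by fun_prop) (-1)
      (fun t => by rw [(hl w u u' hu h1.symm h3.symm).2, hL']; simp) 0 1
    rw [a1, a2, a3, a4]
    ring

/-! ### Dense graphs have large clique minors -/

open Classical in
/-- The number of ordered pairs of adjacent vertices of `W`. -/
def SimpleGraph.adjPairs {V : Type*} (G : SimpleGraph V) (W : Finset V) : ℕ :=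
  ((W ×ˢ W).filter fun q => G.Adj q.1 q.2).card

open Classical in
theorem SimpleGraph.adjPairs_eq_sum {V : Type*} (G : SimpleGraph V) (W : Finset V) :
    G.adjPairs W = ∑ a ∈ W, (W.filter fun b => G.Adj a b).card := by
  unfold SimpleGraph.adjPairs
  rw [Finset.card_filter, Finset.sum_product]
  exact Finset.sum_congr rfl fun a _ => (Finset.card_filter _ _).symm

-- What is lost is the edge `xy`, in both orders, and for each common neighbour one of two edges
-- that become parallel.
open Classical in
theorem SimpleGraph.adjPairs_le_contractInto {V : Type*} (G : SimpleGraph V) (W : Finset V)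
    {x y : V} (hxy : G.Adj x y) (hx : x ∈ W) :
    G.adjPairs W ≤ (G.contractInto x y).adjPairs (W.erase y) + 2 +
      2 * (W.filter fun b => G.Adj x b ∧ G.Adj y b).card := by
  set A := ((W.erase y ×ˢ W.erase y).filter fun q => G.Adj q.1 q.2) with hA
  set N := W.filter fun b => G.Adj y b with hN
  set T := W.filter fun b => G.Adj y b ∧ ¬ G.Adj x b ∧ b ≠ x with hT
  set C := W.filter fun b => G.Adj x b ∧ G.Adj y b with hC
  have h1 : G.adjPairs W ≤ A.card + N.card + N.card := by
    have : ((W ×ˢ W).filter fun q => G.Adj q.1 q.2) ⊆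
        (A ∪ N.image (fun b => (y, b))) ∪ N.image (fun b => (b, y)) := by
      rintro ⟨a, b⟩ hab
      simp only [Finset.mem_filter, Finset.mem_product] at hab
      obtain ⟨⟨ha, hb⟩, hab⟩ := hab
      simp only [Finset.mem_union, Finset.mem_image, hA, hN, Finset.mem_filter,
        Finset.mem_product, Finset.mem_erase, Prod.mk.injEq]
      by_cases h1 : a = y
      · subst h1; exact Or.inl (Or.inr ⟨b, ⟨hb, hab⟩, rfl, rfl⟩)
      by_cases h2 : b = y
      · subst h2; exact Or.inr ⟨a, ⟨ha, hab.symm⟩, rfl, rfl⟩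
      exact Or.inl (Or.inl ⟨⟨⟨h1, ha⟩, h2, hb⟩, hab⟩)
    refine (Finset.card_le_card this).trans ?_
    refine (Finset.card_union_le _ _).trans (add_le_add ?_ Finset.card_image_le)
    exact (Finset.card_union_le _ _).trans (add_le_add le_rfl Finset.card_image_le)
  have h2 : N.card ≤ 1 + C.card + T.card := by
    have : N ⊆ ({x} ∪ C) ∪ T := by
      intro b hb
      simp only [hN, hC, hT, Finset.mem_filter, Finset.mem_union, Finset.mem_singleton] at hb ⊢
      tauto
    refine (Finset.card_le_card this).trans ?_
    refine (Finset.card_union_le _ _).trans (add_le_add ?_ le_rfl)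
    exact (Finset.card_union_le _ _).trans (by simp)
  have h3 : A.card + T.card + T.card ≤ (G.contractInto x y).adjPairs (W.erase y) := by
    have e1 : (T.image (fun b => (x, b))).card = T.card :=
      Finset.card_image_of_injective _ fun a b h => congrArg Prod.snd h
    have e2 : (T.image (fun b => (b, x))).card = T.card :=
      Finset.card_image_of_injective _ fun a b h => congrArg Prod.fst h
    have d1 : Disjoint A (T.image (fun b => (x, b))) := by
      rw [Finset.disjoint_left]
      rintro q hq hq'
      obtain ⟨b, hb, rfl⟩ := Finset.mem_image.1 hq'
      exact (Finset.mem_filter.1 hb).2.2.1 (Finset.mem_filter.1 hq).2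
    have d2 : Disjoint (A ∪ T.image (fun b => (x, b))) (T.image (fun b => (b, x))) := by
      rw [Finset.disjoint_left]
      rintro q hq hq'
      obtain ⟨b, hb, rfl⟩ := Finset.mem_image.1 hq'
      have hb' := (Finset.mem_filter.1 hb).2
      rcases Finset.mem_union.1 hq with hq | hq
      · exact hb'.2.1 (Finset.mem_filter.1 hq).2.symm
      · obtain ⟨c, hc, hcb⟩ := Finset.mem_image.1 hq
        exact hb'.2.2 (congrArg Prod.fst hcb).symm
    rw [← e1, ← Finset.card_union_of_disjoint d1, e1, ← e2, ← Finset.card_union_of_disjoint d2]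
    refine Finset.card_le_card ?_
    have hne : x ≠ y := hxy.ne
    rintro ⟨a, b⟩ hab
    simp only [Finset.mem_union, Finset.mem_image, hA, hT, Finset.mem_filter,
      Finset.mem_product, Finset.mem_erase, Prod.mk.injEq] at hab ⊢
    rcases hab with (⟨⟨⟨h1, h2⟩, h3, h4⟩, h5⟩ | ⟨c, ⟨h1, h2, h3, h4⟩, rfl, rfl⟩) |
      ⟨c, ⟨h1, h2, h3, h4⟩, rfl, rfl⟩
    · exact ⟨⟨⟨h1, h2⟩, h3, h4⟩, h5.ne, h1, h3, Or.inl h5⟩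
    · exact ⟨⟨⟨hne, hx⟩, h2.ne', h1⟩, h4.symm, hne, h2.ne', Or.inr (Or.inl ⟨rfl, h2⟩)⟩
    · exact ⟨⟨⟨h2.ne', h1⟩, hne, hx⟩, h4, h2.ne', hne, Or.inr (Or.inr ⟨rfl, h2⟩)⟩
  omega

theorem SimpleGraph.contractInto_mono {V : Type*} {G H : SimpleGraph V} (h : G ≤ H) (x y : V) :
    G.contractInto x y ≤ H.contractInto x y := by
  rintro a b ⟨h1, h2, h3, h4⟩
  refine ⟨h1, h2, h3, ?_⟩
  rcases h4 with h4 | ⟨h4, h5⟩ | ⟨h4, h5⟩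
  exacts [Or.inl (h h4), Or.inr (Or.inl ⟨h4, h h5⟩), Or.inr (Or.inr ⟨h4, h h5⟩)]

/-- A class of graphs closed under contraction that contains a graph of average degree at least
`2 ^ r` contains a graph with a clique of size `r + 2` (as a not necessarily induced subgraph). -/
theorem SimpleGraph.exists_isNClique_of_adjPairs {V : Type*} (r : ℕ) :
    ∀ (Q : SimpleGraph V → Prop), (∀ G x y, Q G → G.Adj x y → Q (G.contractInto x y)) →
    ∀ (G : SimpleGraph V) (W : Finset V), Q G → W.Nonempty → (∀ a b, G.Adj a b → a ∈ W) →
      2 ^ r * W.card ≤ G.adjPairs W → ∃ H, Q H ∧ ∃ T : Finset V, H.IsNClique (r + 2) T := by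
  classical
  induction r with
  | zero =>
    intro Q _ G W hG hW _ hd
    have : 0 < G.adjPairs W := lt_of_lt_of_le (by simpa using hW.card_pos) hd
    obtain ⟨⟨a, b⟩, hab⟩ := Finset.card_pos.1 this
    have hab := (Finset.mem_filter.1 hab).2
    refine ⟨G, hG, {a, b}, ?_⟩
    rw [SimpleGraph.isNClique_iff]
    refine ⟨?_, Finset.card_pair hab.ne⟩
    rw [Finset.coe_pair, SimpleGraph.isClique_pair]
    exact fun _ => hab
  | succ r ih =>
    intro Q hQ G W
    induction hk : W.card generalizing G W with
    | zero =>
      intro _ hW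
      exact absurd hk (Finset.card_ne_zero.2 hW)
    | succ k ihk =>
      intro hG hW hsupp hd
      -- Contracting an edge with fewer than `2 ^ r` common neighbours loses at most `2 ^ (r + 1)`
      -- ordered pairs and one vertex, which preserves the density. If there is no such edge, every
      -- neighbourhood induces a graph of minimum degree at least `2 ^ r`.
      by_cases hc : ∃ x y, G.Adj x y ∧ (W.filter fun b => G.Adj x b ∧ G.Adj y b).card < 2 ^ r
      · obtain ⟨x, y, hxy, hc⟩ := hc
        have hx := hsupp x y hxy
        have hy := hsupp y x hxy.symm
        refine ihk (G.contractInto x y) (W.erase y) (by simp [Finset.card_erase_of_mem hy, hk])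
          (hQ G x y hG hxy) ⟨x, Finset.mem_erase.2 ⟨hxy.ne, hx⟩⟩ ?_ ?_
        · intro a b hab
          obtain ⟨h1, c, h2⟩ := SimpleGraph.contractInto_adj_left hxy hab
          exact Finset.mem_erase.2 ⟨h1, hsupp a c h2⟩
        · have := G.adjPairs_le_contractInto W hxy hx
          have e : 2 ^ (r + 1) * (k + 1) = 2 ^ (r + 1) * k + 2 * 2 ^ r := by ring
          omega
      · push Not at hc
        have hpos : 0 < G.adjPairs W := lt_of_lt_of_le (by positivity) hd
        obtain ⟨⟨x, z⟩, hxz⟩ := Finset.card_pos.1 hpos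
        have hxz := (Finset.mem_filter.1 hxz).2
        set W' := W.filter fun b => G.Adj x b with hW'
        let H : SimpleGraph V :=
          { Adj := fun a b => G.Adj a b ∧ G.Adj x a ∧ G.Adj x b
            symm := ⟨fun a b h => ⟨h.1.symm, h.2.2, h.2.1⟩⟩
            loopless := ⟨fun a h => h.1.ne rfl⟩ }
        -- The class for the inner induction: graphs that avoid `x` and lie in a member `M` of `Q`
        -- in which `x` is joined to all their non-isolated vertices. Contractions are carried out
        -- in `M` simultaneously, so `x` finally extends the clique.
        have hQ' : ∀ H u y, ((∀ a, ¬ H.Adj x a) ∧ ∃ M, Q M ∧ H ≤ M ∧ ∀ a b, H.Adj a b → M.Adj x a) →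
            H.Adj u y → ((∀ a, ¬ (H.contractInto u y).Adj x a) ∧ ∃ M, Q M ∧ H.contractInto u y ≤ M ∧
              ∀ a b, (H.contractInto u y).Adj a b → M.Adj x a) := by
          rintro H u y ⟨hx, M, hM, hle, hadj⟩ huy
          refine ⟨fun a ha => ?_, M.contractInto u y, hQ M u y hM (hle huy),
            SimpleGraph.contractInto_mono hle u y, fun a b hab => ?_⟩
          · obtain ⟨-, c, hc⟩ := SimpleGraph.contractInto_adj_left huy ha
            exact hx c hc
          · obtain ⟨h1, c, hc⟩ := SimpleGraph.contractInto_adj_left huy hab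
            have := hadj a c hc
            exact ⟨this.ne, fun h => hx u (h ▸ huy.symm), h1, Or.inl this⟩
        have hd' : 2 ^ r * W'.card ≤ H.adjPairs W' := by
          rw [SimpleGraph.adjPairs_eq_sum, mul_comm, ← smul_eq_mul]
          refine Finset.card_nsmul_le_sum _ _ _ fun a ha => ?_
          have hxa := (Finset.mem_filter.1 ha).2
          refine (hc x a hxa).trans (Finset.card_le_card fun b hb => ?_)
          simp only [hW', Finset.mem_filter] at hb ⊢
          exact ⟨⟨hb.1, hb.2.1⟩, hb.2.2, hxa, hb.2.1⟩
        obtain ⟨H', ⟨-, M, hM, hle, hadj⟩, T, hT⟩ := ih _ hQ' H W'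
          ⟨fun a ha => ha.2.1.ne rfl, G, hG, fun a b h => h.1, fun a b h => h.2.1⟩
          ⟨z, Finset.mem_filter.2 ⟨hsupp z x hxz.symm, hxz⟩⟩
          (fun a b h => Finset.mem_filter.2 ⟨hsupp a b h.1, h.2.1⟩) hd'
        refine ⟨M, hM, insert x T, (hT.mono hle).insert ?_⟩
        intro b hb
        have : 1 < T.card := by rw [hT.card_eq]; omega
        obtain ⟨c, hc, hcb⟩ := Finset.exists_mem_ne this b
        exact hadj b c (hT.isClique hb hc hcb.symm)

/-- A finite set of `n` vertices of a planar map spans at most `4 n` edges. -/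
theorem PlanarMap.adjPairs_le {V : Type*} (G : PlanarMap V) (W : Finset V) :
    G.graph.adjPairs W ≤ 8 * W.card := by
  classical
  by_contra! hlt
  have hW : W.Nonempty := by
    rw [Finset.nonempty_iff_ne_empty]
    rintro rfl
    simp [SimpleGraph.adjPairs] at hlt
  let H : SimpleGraph V :=
    { Adj := fun a b => G.graph.Adj a b ∧ a ∈ W ∧ b ∈ W
      symm := ⟨fun a b h => ⟨h.1.symm, h.2.2, h.2.1⟩⟩
      loopless := ⟨fun a h => h.1.ne rfl⟩ }
  have hH : H.adjPairs W = G.graph.adjPairs W := by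
    unfold SimpleGraph.adjPairs
    congr 1
    ext q
    simp only [Finset.mem_filter, Finset.mem_product, H]
    tauto
  obtain ⟨θ, hθ⟩ := G.exists_angleSystem
  -- With `r = 3`, density `2 ^ 3 = 8` yields a clique of size `3 + 2 = 5`.
  obtain ⟨K, ⟨θ', hθ'⟩, T, hT⟩ := SimpleGraph.exists_isNClique_of_adjPairs 3
    (fun H => ∃ θ, AngleSystem G.pt H θ) (fun H x y ⟨θ, h⟩ hxy => h.contractInto hxy) H W
    ⟨θ, hθ.mono fun a b h => h.1⟩ hW (fun a b h => h.2.1) (by omega)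
  have hc : T.card = 5 := hT.card_eq
  let g : Fin 5 → V := fun i => (T.equivFin.symm (Fin.cast hc.symm i) : V)
  have hg : Function.Injective g := fun i j h => by
    simpa [g] using h
  exact hθ'.not_isNClique_five G.pt_injective g hg fun i j hij =>
    hT.isClique (T.equivFin.symm _).2 (T.equivFin.symm _).2 (hg.ne hij)

/-! ### The roundabout graph -/

namespace PlanarMap

variable {V : Type*} (G : PlanarMap V)

theorem finite_darts_at (hfin : ∀ v : V, (G.graph.neighborSet v).Finite) (v : V) :
    {d : G.graph.Dart | d.fst = v}.Finite := by
  refine Set.Finite.of_finite_image ((hfin v).subset ?_) (f := fun d => d.snd) ?_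
  · rintro _ ⟨d, rfl, rfl⟩
    exact d.adj
  · rintro d hd d' hd' h
    exact SimpleGraph.Dart.ext _ _ (Prod.ext (hd.trans hd'.symm) h)

theorem radius_pos (hfin : ∀ v : V, (G.graph.neighborSet v).Finite) (d : G.graph.Dart) :
    0 < G.radius d.fst := by
  have hne : (G.pt '' G.graph.neighborSet d.fst).Nonempty := ⟨_, d.snd, d.adj, rfl⟩
  have hcl : IsClosed (G.pt '' G.graph.neighborSet d.fst) := ((hfin d.fst).image _).isClosed
  refine half_pos ((hcl.notMem_iff_infDist_pos hne).1 ?_)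
  rintro ⟨w, hw, h⟩
  exact (G.graph.ne_of_adj hw) (G.pt_injective h).symm

theorem dist_exitTime (hfin : ∀ v : V, (G.graph.neighborSet v).Finite) (d : G.graph.Dart) :
    dist (G.arc d.fst d.snd d.adj (G.exitTime d)) (G.pt d.fst) = G.radius d.fst := by
  set γ := G.arc d.fst d.snd d.adj
  set r := G.radius d.fst
  have hr : 0 < r := G.radius_pos hfin d
  have hc : Continuous fun t => dist (γ t) (G.pt d.fst) := by fun_prop
  set T := {t | r ≤ dist (γ t) (G.pt d.fst)} with hT
  have hTc : IsClosed T := isClosed_le continuous_const hc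
  have hT1 : (1 : unitInterval) ∈ T := by
    have h1 : Metric.infDist (G.pt d.fst) (G.pt '' G.graph.neighborSet d.fst) ≤
        dist (G.pt d.fst) (G.pt d.snd) := Metric.infDist_le_dist_of_mem ⟨_, d.adj, rfl⟩
    have h2 : r = Metric.infDist (G.pt d.fst) (G.pt '' G.graph.neighborSet d.fst) / 2 := rfl
    simp only [hT, Set.mem_ofPred_eq, γ, Path.target]
    rw [dist_comm]
    linarith
  have hmem : G.exitTime d ∈ T := hTc.csInf_mem ⟨1, hT1⟩ (OrderBot.bddBelow _)
  refine le_antisymm ?_ hmem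
  by_contra! hlt
  have h0 : dist (γ 0) (G.pt d.fst) < r := by simpa using hr
  obtain ⟨t, ht, hte⟩ := intermediate_value_Icc (G.exitTime d).2.1 (f := fun s : ℝ =>
    dist (γ.extend s) (G.pt d.fst)) (by fun_prop) (a := 0) (b := (G.exitTime d : ℝ))
    (show r ∈ _ by
      constructor
      · simpa using hr.le
      · rw [Path.extend_apply]
        exact hlt.le)
  have htI : t ∈ unitInterval := ⟨ht.1, ht.2.trans (G.exitTime d).2.2⟩
  simp only at hte
  rw [Path.extend_apply _ htI] at hte
  have : G.exitTime d ≤ ⟨t, htI⟩ := csInf_le (OrderBot.bddBelow _) hte.ge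
  have heq : G.exitTime d = ⟨t, htI⟩ := le_antisymm this ht.2
  rw [heq] at hlt
  exact hlt.ne hte.symm

/-- Equal angles mean equal exit points, as both lie on the same circle. Arcs of distinct edges meet
only in a vertex; being at positive distance from the centre, it would be the far end of both darts.
-/
theorem exitAngle_injective (hfin : ∀ v : V, (G.graph.neighborSet v).Finite)
    {d d' : G.graph.Dart} (hfst : d.fst = d'.fst) (h : G.exitAngle d = G.exitAngle d') :
    d = d' := by
  by_contra hne
  have hr := G.radius_pos hfin d
  have hd := G.dist_exitTime hfin d
  have hd' := G.dist_exitTime hfin d'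
  have hd' : dist (G.arc d'.fst d'.snd d'.adj (G.exitTime d')) (G.pt d.fst) = G.radius d.fst :=
    (congrArg _ (congrArg G.pt hfst)).trans (hd'.trans (congrArg G.radius hfst.symm))
  have hpt : G.arc d.fst d.snd d.adj (G.exitTime d) = G.arc d'.fst d'.snd d'.adj (G.exitTime d') := by
    have harg : (G.arc d.fst d.snd d.adj (G.exitTime d) - G.pt d.fst).arg =
        (G.arc d'.fst d'.snd d'.adj (G.exitTime d') - G.pt d.fst).arg := by
      have hsub : G.arc d'.fst d'.snd d'.adj (G.exitTime d') - G.pt d.fst =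
          G.arc d'.fst d'.snd d'.adj (G.exitTime d') - G.pt d'.fst :=
        congrArg _ (congrArg G.pt hfst)
      rw [hsub]
      exact Complex.arg_coe_angle_eq_iff.1 h
    have := Complex.ext_norm_arg (by rw [← dist_eq_norm, ← dist_eq_norm, hd, hd']) harg
    exact sub_left_injective this
  have hs : s(d.fst, d.snd) ≠ s(d'.fst, d'.snd) := by
    intro hs
    rcases Sym2.eq_iff.1 hs with ⟨-, h2⟩ | ⟨-, h2⟩
    · exact hne (SimpleGraph.Dart.ext _ _ (Prod.ext hfst h2))
    · exact d.adj.ne (hfst.trans h2.symm)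
  obtain ⟨x, hx⟩ := G.arc_disjoint _ _ d.adj _ _ d'.adj _ _ hs hpt
  have hxv : x ≠ d.fst := by
    rintro rfl
    rw [hx, dist_self] at hd
    exact hr.ne hd
  have h1 := (G.arc_vertex _ _ _ _ _ hx).resolve_left hxv
  have h2 := (G.arc_vertex _ _ _ _ _ (hpt.symm.trans hx)).resolve_left (hfst ▸ hxv)
  exact hne (SimpleGraph.Dart.ext _ _ (Prod.ext hfst (h1.symm.trans h2)))

theorem IsNextAt.right_unique (hfin : ∀ v : V, (G.graph.neighborSet v).Finite)
    {d d' d'' : G.graph.Dart} (h : G.IsNextAt d d') (h' : G.IsNextAt d d'') : d' = d'' := by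
  have h1 := h.2.2 d'' h'.1.symm
  have h2 := h'.2.2 d' h.1.symm
  rw [← btw_iff_not_sbtw] at h1 h2
  rcases Btw.btw.antisymm h1 h2.cyclic_left.cyclic_left with h3 | h3 | h3
  · exact G.exitAngle_injective hfin (h.1.symm.trans h'.1) h3
  · exact absurd (G.exitAngle_injective hfin h'.1.symm h3).symm h'.2.1
  · exact absurd (G.exitAngle_injective hfin h.1 h3) h.2.1

theorem IsNextAt.left_unique (hfin : ∀ v : V, (G.graph.neighborSet v).Finite)
    {d d' d'' : G.graph.Dart} (h : G.IsNextAt d' d) (h' : G.IsNextAt d'' d) : d' = d'' := by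
  have h1 := h.2.2 d'' (h'.1.trans h.1.symm)
  have h2 := h'.2.2 d' (h.1.trans h'.1.symm)
  rw [← btw_iff_not_sbtw] at h1 h2
  rcases Btw.btw.antisymm h1 h2.cyclic_left with h3 | h3 | h3
  · exact absurd (G.exitAngle_injective hfin h'.1.symm h3).symm h'.2.1
  · exact (G.exitAngle_injective hfin (h'.1.trans h.1.symm) h3).symm
  · exact absurd (G.exitAngle_injective hfin h.1 h3) h.2.1

theorem ncard_neighborSet_roundabout_le (hfin : ∀ v : V, (G.graph.neighborSet v).Finite)
    (d : G.graph.Dart) :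
    (G.roundabout.neighborSet d).Finite ∧ (G.roundabout.neighborSet d).ncard ≤ 3 := by
  have hsub : G.roundabout.neighborSet d ⊆
      {d.symm} ∪ {d' | G.IsNextAt d d'} ∪ {d' | G.IsNextAt d' d} := by
    rintro d' (h | h | h)
    exacts [Or.inl (Or.inl h), Or.inl (Or.inr h), Or.inr h]
  have s1 : {d' | G.IsNextAt d d'}.Subsingleton := fun _ h _ h' => h.right_unique G hfin h'
  have s2 : {d' | G.IsNextAt d' d}.Subsingleton := fun _ h _ h' => h.left_unique G hfin h'
  have hf : ({d.symm} ∪ {d' | G.IsNextAt d d'} ∪ {d' | G.IsNextAt d' d}).Finite :=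
    ((Set.finite_singleton _).union s1.finite).union s2.finite
  refine ⟨hf.subset hsub, (Set.ncard_le_ncard hsub hf).trans ?_⟩
  refine (Set.ncard_union_le _ _).trans ?_
  have := Set.ncard_union_le {d.symm} {d' | G.IsNextAt d d'}
  have e1 := (Set.ncard_le_one s1.finite).2 fun a ha b hb => s1 ha hb
  have e2 := (Set.ncard_le_one s2.finite).2 fun a ha b hb => s2 ha hb
  rw [Set.ncard_singleton] at this
  omega

/-- If some but not all darts at a vertex lie in `D`, then a dart in `D` is directly followed by
one outside `D`. -/
theorem exists_isNextAt (hfin : ∀ v : V, (G.graph.neighborSet v).Finite)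
    (D : Set G.graph.Dart) {d d' : G.graph.Dart} (hd : d ∈ D) (hd' : d' ∉ D)
    (hfst : d.fst = d'.fst) :
    ∃ e e', e.fst = d.fst ∧ e ∈ D ∧ e' ∉ D ∧ G.IsNextAt e e' := by
  classical
  set F := (G.finite_darts_at hfin d.fst).toFinset with hF
  have hFm : ∀ x, x ∈ F ↔ x.fst = d.fst := fun x => by simp [hF]
  set M : G.graph.Dart → G.graph.Dart → Finset G.graph.Dart := fun a b =>
    F.filter fun x => sbtw (G.exitAngle a) (G.exitAngle x) (G.exitAngle b) with hM
  -- Induction on the number of darts strictly between `a` and `b`: a dart in between replaces `a`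
  -- or `b`, according to whether it lies in `D`.
  suffices H : ∀ n, ∀ a b, (M a b).card = n → a.fst = d.fst → b.fst = d.fst → a ∈ D → b ∉ D →
      ∃ e e', e.fst = d.fst ∧ e ∈ D ∧ e' ∉ D ∧ G.IsNextAt e e' from
    H _ d d' rfl rfl hfst.symm hd hd'
  intro n
  induction n using Nat.strong_induction_on with
  | _ n ih =>
    intro a b hn ha hb haD hbD
    by_cases hnext : G.IsNextAt a b
    · exact ⟨a, b, ha, haD, hbD, hnext⟩
    have : ∃ x : G.graph.Dart, x.fst = a.fst ∧
        sbtw (G.exitAngle a) (G.exitAngle x) (G.exitAngle b) := by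
      by_contra! hno
      exact hnext ⟨ha.trans hb.symm, fun h => hbD (h ▸ haD), fun x hx => hno x hx⟩
    obtain ⟨x, hx, hs⟩ := this
    have hxF : x ∈ M a b := Finset.mem_filter.2 ⟨(hFm x).2 (hx.trans ha), hs⟩
    by_cases hxD : x ∈ D
    · refine ih _ ?_ x b rfl (hx.trans ha) hb hxD hbD
      rw [← hn]
      refine Finset.card_lt_card ⟨?_, fun hsub => ?_⟩
      · intro y hy
        rw [Finset.mem_filter] at hy ⊢
        exact ⟨hy.1, hs.trans_left hy.2⟩
      · exact sbtw_irrefl_left (Finset.mem_filter.1 (hsub hxF)).2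
    · refine ih _ ?_ a x rfl ha (hx.trans ha) haD hxD
      rw [← hn]
      refine Finset.card_lt_card ⟨?_, fun hsub => ?_⟩
      · intro y hy
        rw [Finset.mem_filter] at hy ⊢
        exact ⟨hy.1, sbtw_trans_right hy.2 hs⟩
      · exact sbtw_irrefl_right (Finset.mem_filter.1 (hsub hxF)).2

end PlanarMap

/-- The (oriented) edge boundary of a vertex set. -/
def SimpleGraph.outDarts {X : Type*} (R : SimpleGraph X) (D : Set X) : Set (X × X) :=
  {q | q.1 ∈ D ∧ q.2 ∉ D ∧ R.Adj q.1 q.2}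

theorem SimpleGraph.finite_outDarts {X : Type*} {R : SimpleGraph X}
    (hR : ∀ x, (R.neighborSet x).Finite) (D : Finset X) : (R.outDarts D).Finite := by
  refine (D.finite_toSet.biUnion fun x _ => (Set.finite_singleton x).prod (hR x)).subset ?_
  rintro ⟨x, y⟩ ⟨h1, -, h3⟩
  exact Set.mem_biUnion h1 ⟨rfl, h3⟩

/-- `S` collects the vertices with all darts in `D`, `Pt` those with only some. A neighbour of `S`
outside `S` is in `Pt` or is the head of a dart in `Out`, so `γ * |S| ≤ 2 * b`. Then `|D| ≤ 8 * (|S|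
+ |Pt|) + |Out|` gives the constant. -/
theorem PlanarMap.card_le_ncard_outDarts {V : Type*} (G : PlanarMap V)
    (hfin : ∀ v : V, (G.graph.neighborSet v).Finite) {γ : ℝ} (hγ : 0 < γ)
    (hiso : ∀ S : Finset V, γ * (S.card : ℝ) ≤ ((G.graph.vertexBoundary ↑S).ncard : ℝ))
    (D : Finset G.graph.Dart) :
    (D.card : ℝ) ≤ (16 / γ + 9) * ((G.roundabout.outDarts D).ncard : ℝ) := by
  classical
  have hB : (G.roundabout.outDarts D).Finite :=
    SimpleGraph.finite_outDarts (fun d => (G.ncard_neighborSet_roundabout_le hfin d).1) D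
  set b := (G.roundabout.outDarts D).ncard with hb
  set W := D.image fun d => d.fst with hW
  set S := W.filter fun v => ∀ d : G.graph.Dart, d.fst = v → d ∈ D with hS
  set Pt := W.filter fun v => ¬ ∀ d : G.graph.Dart, d.fst = v → d ∈ D with hPt
  set In := D.filter fun d => d.symm ∈ D with hIn
  set Out := D.filter fun d => ¬ d.symm ∈ D with hOut
  have hWc : S.card + Pt.card = W.card := Finset.card_filter_add_card_filter_not _
  have hDc : In.card + Out.card = D.card := Finset.card_filter_add_card_filter_not _
  have hInc : In.card ≤ 8 * W.card := by
    refine le_trans ?_ (G.adjPairs_le W)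
    refine Finset.card_le_card_of_injOn (fun d => d.toProd) ?_ ?_
    · intro d hd
      have hd := Finset.mem_filter.1 hd
      simp only [Finset.coe_filter, Finset.mem_product, Set.mem_ofPred_eq]
      exact ⟨⟨Finset.mem_image_of_mem _ hd.1, Finset.mem_image.2 ⟨d.symm, hd.2, rfl⟩⟩, d.adj⟩
    · intro d _ d' _ h
      exact SimpleGraph.Dart.ext _ _ h
  have hOutb : Out.card ≤ b := by
    have : (Out : Set G.graph.Dart) ⊆ Prod.fst '' G.roundabout.outDarts D := by
      intro d hd
      have hd := Finset.mem_filter.1 hd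
      exact ⟨(d, d.symm), ⟨hd.1, hd.2, Or.inl rfl⟩, rfl⟩
    rw [← Set.ncard_coe_finset]
    exact (Set.ncard_le_ncard this (hB.image _)).trans (Set.ncard_image_le hB)
  have hPtb : Pt.card ≤ b := by
    have : (Pt : Set V) ⊆ (fun q => q.1.fst) '' G.roundabout.outDarts D := by
      intro v hv
      obtain ⟨hv, hv'⟩ := Finset.mem_filter.1 hv
      obtain ⟨d, hd, rfl⟩ := Finset.mem_image.1 hv
      push Not at hv'
      obtain ⟨d', hd', hd'D⟩ := hv'
      obtain ⟨e, e', h1, h2, h3, h4⟩ := G.exists_isNextAt hfin (D : Set G.graph.Dart) hd hd'D hd'.symm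
      exact ⟨(e, e'), ⟨h2, h3, Or.inr (Or.inl h4)⟩, h1⟩
    rw [← Set.ncard_coe_finset]
    exact (Set.ncard_le_ncard this (hB.image _)).trans (Set.ncard_image_le hB)
  have hSb : (G.graph.vertexBoundary ↑S).ncard ≤ Out.card + Pt.card := by
    have : G.graph.vertexBoundary ↑S ⊆ ((Out.image fun d => d.snd) ∪ Pt : Finset V) := by
      rintro w ⟨hw, v, hv, hvw⟩
      have hd : (⟨(v, w), hvw⟩ : G.graph.Dart) ∈ D := (Finset.mem_filter.1 hv).2 _ rfl
      rw [Finset.coe_union]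
      by_cases hs : (⟨(v, w), hvw⟩ : G.graph.Dart).symm ∈ D
      · have hwW : w ∈ W := Finset.mem_image.2 ⟨_, hs, rfl⟩
        exact Or.inr (Finset.mem_filter.2 ⟨hwW, fun h => hw (Finset.mem_filter.2 ⟨hwW, h⟩)⟩)
      · exact Or.inl (Finset.mem_image.2 ⟨_, Finset.mem_filter.2 ⟨hd, hs⟩, rfl⟩)
    refine (Set.ncard_le_ncard this (Finset.finite_toSet _)).trans ?_
    rw [Set.ncard_coe_finset]
    exact (Finset.card_union_le _ _).trans (add_le_add Finset.card_image_le le_rfl)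
  have hSr : (S.card : ℝ) ≤ 2 * b / γ := by
    rw [le_div_iff₀ hγ, mul_comm]
    refine (hiso S).trans ?_
    have : (G.graph.vertexBoundary ↑S).ncard ≤ 2 * b := by omega
    exact_mod_cast this
  have hDr : (D.card : ℝ) ≤ 8 * S.card + 9 * b := by
    have : D.card ≤ 8 * S.card + 9 * b := by omega
    exact_mod_cast this
  calc (D.card : ℝ) ≤ 8 * S.card + 9 * b := hDr
    _ ≤ 8 * (2 * b / γ) + 9 * b := by linarith
    _ = (16 / γ + 9) * b := by ring

/-- The roundabout graph of a non-amenable planar map satisfies a strong isoperimetric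
inequality. -/
theorem PlanarMap.roundabout_isoperimetric {V : Type*} (G : PlanarMap V)
    (hfin : ∀ v : V, (G.graph.neighborSet v).Finite) (hna : G.graph.IsNonamenable) :
    ∃ K : ℝ, 0 < K ∧ ∀ D : Finset G.graph.Dart,
      ∑ d ∈ D, ((G.roundabout.neighborSet d).ncard : ℝ) ≤
        K * ((G.roundabout.outDarts D).ncard : ℝ) := by
  obtain ⟨-, γ, hγ, hiso⟩ := hna
  refine ⟨3 * (16 / γ + 9), by positivity, fun D => ?_⟩
  have h1 : ∑ d ∈ D, ((G.roundabout.neighborSet d).ncard : ℝ) ≤ D.card • (3 : ℝ) :=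
    Finset.sum_le_card_nsmul _ _ _ fun d _ => by
      exact_mod_cast (G.ncard_neighborSet_roundabout_le hfin d).2
  have h2 := G.card_le_ncard_outDarts hfin hγ hiso D
  rw [nsmul_eq_mul] at h1
  linarith

/-! ### From isoperimetry to a Poincaré inequality -/

open Classical in
/-- The adjacency matrix as a real kernel. -/
def SimpleGraph.adjWeight {X : Type*} (R : SimpleGraph X) (q : X × X) : ℝ :=
  if R.Adj q.1 q.2 then 1 else 0

theorem SimpleGraph.adjWeight_nonneg {X : Type*} (R : SimpleGraph X) (q : X × X) :
    0 ≤ R.adjWeight q := by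
  unfold SimpleGraph.adjWeight
  split_ifs <;> norm_num

theorem SimpleGraph.adjWeight_swap {X : Type*} (R : SimpleGraph X) (q : X × X) :
    R.adjWeight q.swap = R.adjWeight q := by
  by_cases h : R.Adj q.1 q.2
  · simp [SimpleGraph.adjWeight, h, h.symm]
  · simp [SimpleGraph.adjWeight, h, mt SimpleGraph.Adj.symm h]

theorem SimpleGraph.sum_adjWeight_swap {X : Type*} (R : SimpleGraph X) (B : Finset X)
    (F : X × X → ℝ) :
    ∑ q ∈ B ×ˢ B, R.adjWeight q * F q.swap = ∑ q ∈ B ×ˢ B, R.adjWeight q * F q := by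
  refine Finset.sum_bij' (fun q _ => q.swap) (fun q _ => q.swap) ?_ ?_ ?_ ?_ ?_ <;>
    simp +contextual [SimpleGraph.adjWeight_swap]

theorem SimpleGraph.sum_adjWeight_left {X : Type*} {R : SimpleGraph X} {N : X → Finset X}
    (hN : ∀ x y, y ∈ N x ↔ R.Adj x y) {B : Finset X} {x : X} (hB : N x ⊆ B) (u : X → ℝ) :
    ∑ y ∈ B, R.adjWeight (x, y) * u y = ∑ y ∈ N x, u y := by
  classical
  have : ∀ y, R.adjWeight (x, y) * u y = if y ∈ N x then u y else 0 := fun y => by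
    simp [SimpleGraph.adjWeight, hN]
  rw [Finset.sum_congr rfl fun y _ => this y, ← Finset.sum_filter,
    Finset.filter_mem_eq_inter, Finset.inter_eq_right.2 hB]

/-- A discrete coarea argument: subtracting from `f` its least positive value `m` on the support `D`
splits both sides additively. The layer `m * χ` is handled by isoperimetry for `D`, and the
remainder `g` has smaller support. -/
theorem SimpleGraph.sum_card_mul_le {X : Type*} {R : SimpleGraph X} {N : X → Finset X}
    (hN : ∀ x y, y ∈ N x ↔ R.Adj x y) {K : ℝ} (hK : 0 < K)
    (hiso : ∀ D : Finset X, ∑ d ∈ D, ((N d).card : ℝ) ≤ K * ((R.outDarts D).ncard : ℝ))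
    {S B : Finset X} (hSB : S ⊆ B) (hB : ∀ x ∈ S, N x ⊆ B) :
    ∀ f : X → ℝ, (∀ x, 0 ≤ f x) → (∀ x, x ∉ S → f x = 0) →
      ∑ x ∈ S, ((N x).card : ℝ) * f x ≤
        K * ∑ q ∈ B ×ˢ B, R.adjWeight q * |f q.1 - f q.2| := by
  classical
  intro f
  induction hn : (S.filter fun x => 0 < f x).card using Nat.strong_induction_on generalizing f with
  | _ n ih =>
    intro hf0 hfS
    set D := S.filter fun x => 0 < f x with hD
    have hfD : ∀ x, x ∉ D → f x = 0 := fun x hx => by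
      by_cases hxS : x ∈ S
      · exact le_antisymm (not_lt.1 fun h => hx (Finset.mem_filter.2 ⟨hxS, h⟩)) (hf0 x)
      · exact hfS x hxS
    rcases D.eq_empty_or_nonempty with hDe | hDne
    · have hz : ∀ x, f x = 0 := fun x => hfD x (by simp [hDe])
      simp [hz]
    obtain ⟨x₀, hx₀, hmin⟩ := D.exists_min_image f hDne
    set m := f x₀ with hm
    have hm0 : 0 < m := (Finset.mem_filter.1 hx₀).2
    set χ : X → ℝ := fun x => if x ∈ D then 1 else 0 with hχ
    set g : X → ℝ := fun x => f x - m * χ x with hg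
    have hg0 : ∀ x, 0 ≤ g x := fun x => by
      by_cases hx : x ∈ D
      · simp [hg, hχ, hx, hmin x hx]
      · simp [hg, hχ, hx, hf0 x]
    have hgD : ∀ x, x ∉ D → g x = 0 := fun x hx => by simp [hg, hχ, hx, hfD x hx]
    have hgS : ∀ x, x ∉ S → g x = 0 := fun x hx =>
      hgD x fun h => hx (Finset.mem_filter.1 h).1
    have hlt : (S.filter fun x => 0 < g x).card < n := by
      rw [← hn]
      refine Finset.card_lt_card ⟨fun x hx => ?_, fun hsub => ?_⟩
      · by_contra hxD
        exact (Finset.mem_filter.1 hx).2.ne' (hgD x hxD)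
      · have := (Finset.mem_filter.1 (hsub hx₀)).2
        simp [hg, hχ, hx₀, ← hm] at this
    have hgle := ih _ hlt g rfl hg0 hgS
    have habs : ∀ q : X × X, |f q.1 - f q.2| = m * |χ q.1 - χ q.2| + |g q.1 - g q.2| := by
      rintro ⟨x, y⟩
      by_cases hx : x ∈ D <;> by_cases hy : y ∈ D
      · simp [hg, hχ, hx, hy]
      · have := hg0 x
        simp only [hg, hχ, hx, hy, if_true, if_false, hfD y hy] at this ⊢
        rw [abs_of_nonneg (by linarith [hf0 x]), abs_of_nonneg (by norm_num),
          abs_of_nonneg (by linarith)]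
        ring
      · have := hg0 y
        simp only [hg, hχ, hx, hy, if_true, if_false, hfD x hx] at this ⊢
        rw [abs_of_nonpos (by linarith [hf0 y]), abs_of_nonpos (by norm_num),
          abs_of_nonpos (by linarith)]
        ring
      · simp [hg, hχ, hx, hy]
    have hχle : ((R.outDarts D).ncard : ℝ) ≤ ∑ q ∈ B ×ˢ B, R.adjWeight q * |χ q.1 - χ q.2| := by
      set O : Finset (X × X) :=
        (B ×ˢ B).filter fun q : X × X => q.1 ∈ D ∧ q.2 ∉ D ∧ R.Adj q.1 q.2 with hO
      have hsub : R.outDarts D ⊆ O := by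
        rintro ⟨x, y⟩ ⟨h1, h2, h3⟩
        have hxS := (Finset.mem_filter.1 h1).1
        refine Finset.mem_filter.2 ⟨Finset.mem_product.2 ⟨hSB hxS, hB x hxS ((hN x y).2 h3)⟩, h1, h2, h3⟩
      have h1 := Set.ncard_le_ncard hsub (Finset.finite_toSet _)
      rw [Set.ncard_coe_finset] at h1
      refine (Nat.cast_le.2 h1).trans ?_
      rw [hO, Finset.card_filter]
      push_cast
      refine Finset.sum_le_sum fun q _ => ?_
      split_ifs with h
      · simp [SimpleGraph.adjWeight, hχ, h.1, h.2.1, h.2.2]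
      · exact mul_nonneg (R.adjWeight_nonneg q) (abs_nonneg _)
    have hsplit : ∑ x ∈ S, ((N x).card : ℝ) * f x =
        m * ∑ x ∈ D, ((N x).card : ℝ) + ∑ x ∈ S, ((N x).card : ℝ) * g x := by
      have : ∑ x ∈ D, ((N x).card : ℝ) = ∑ x ∈ S, ((N x).card : ℝ) * χ x := by
        rw [← Finset.sum_subset (show D ⊆ S from Finset.filter_subset _ S) (f := fun x => ((N x).card : ℝ) * χ x)]
        · exact Finset.sum_congr rfl fun x hx => by simp [hχ, hx]
        · intro x _ hx
          simp [hχ, hx]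
      rw [this, Finset.mul_sum, ← Finset.sum_add_distrib]
      exact Finset.sum_congr rfl fun x _ => by simp only [hg]; ring
    have hsplit' : ∑ q ∈ B ×ˢ B, R.adjWeight q * |f q.1 - f q.2| =
        m * ∑ q ∈ B ×ˢ B, R.adjWeight q * |χ q.1 - χ q.2| +
          ∑ q ∈ B ×ˢ B, R.adjWeight q * |g q.1 - g q.2| := by
      rw [Finset.mul_sum, ← Finset.sum_add_distrib]
      exact Finset.sum_congr rfl fun q _ => by rw [habs]; ring
    rw [hsplit, hsplit']
    have := mul_le_mul_of_nonneg_left ((hiso D).trans (mul_le_mul_of_nonneg_left hχle hK.le)) hm0.le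
    linarith

theorem SimpleGraph.poincare {X : Type*} {R : SimpleGraph X} {N : X → Finset X}
    (hN : ∀ x y, y ∈ N x ↔ R.Adj x y) {K : ℝ} (hK : 0 < K)
    (hiso : ∀ D : Finset X, ∑ d ∈ D, ((N d).card : ℝ) ≤ K * ((R.outDarts D).ncard : ℝ))
    {S B : Finset X} (hSB : S ⊆ B) (hB : ∀ x ∈ S, N x ⊆ B) (u : X → ℝ)
    (hu : ∀ x, x ∉ S → u x = 0) :
    ∑ x ∈ S, ((N x).card : ℝ) * u x ^ 2 ≤
      4 * K ^ 2 * ∑ q ∈ B ×ˢ B, R.adjWeight q * (u q.1 - u q.2) ^ 2 := by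
  have h1 := SimpleGraph.sum_card_mul_le hN hK hiso hSB hB (fun x => u x ^ 2)
    (fun x => sq_nonneg _) (fun x hx => by simp [hu x hx])
  have hsq : ∑ q ∈ B ×ˢ B, R.adjWeight q * u q.1 ^ 2 = ∑ x ∈ S, ((N x).card : ℝ) * u x ^ 2 := by
    rw [Finset.sum_product, ← Finset.sum_subset hSB]
    · refine Finset.sum_congr rfl fun x hx => ?_
      rw [SimpleGraph.sum_adjWeight_left hN (hB x hx) (fun _ => u x ^ 2)]
      simp
    · intro x _ hx
      simp [hu x hx]
  have hsq' : ∑ q ∈ B ×ˢ B, R.adjWeight q * u q.2 ^ 2 = ∑ x ∈ S, ((N x).card : ℝ) * u x ^ 2 := by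
    rw [← hsq, ← SimpleGraph.sum_adjWeight_swap]
    rfl
  have h2 : ∑ q ∈ B ×ˢ B, R.adjWeight q * |u q.1 ^ 2 - u q.2 ^ 2| ≤
      ∑ q ∈ B ×ˢ B, (2 * K * (R.adjWeight q * (u q.1 - u q.2) ^ 2) +
        1 / (4 * K) * (R.adjWeight q * u q.1 ^ 2 + R.adjWeight q * u q.2 ^ 2)) := by
    refine Finset.sum_le_sum fun q _ => ?_
    -- Factor the difference of squares and apply the weighted AM-GM inequality. The weight makes
    -- the last term, after multiplication by `K` and summation, exactly half of the left side of
    -- the claim.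
    have h3 : |u q.1 ^ 2 - u q.2 ^ 2| ≤
        2 * K * (u q.1 - u q.2) ^ 2 + 1 / (4 * K) * (u q.1 ^ 2 + u q.2 ^ 2) := by
      have e1 : 2 * K * (u q.1 - u q.2) ^ 2 + 1 / (4 * K) * (u q.1 ^ 2 + u q.2 ^ 2) =
          (u q.1 ^ 2 - u q.2 ^ 2) + (8 * K) * ((u q.1 - u q.2) / 2 - (u q.1 + u q.2) / (8 * K)) ^ 2
          + (u q.1 - u q.2) ^ 2 * (1 / (8 * K)) := by
        field_simp
        ring
      have e2 : 2 * K * (u q.1 - u q.2) ^ 2 + 1 / (4 * K) * (u q.1 ^ 2 + u q.2 ^ 2) =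
          -(u q.1 ^ 2 - u q.2 ^ 2) + (8 * K) * ((u q.1 - u q.2) / 2 + (u q.1 + u q.2) / (8 * K)) ^ 2
          + (u q.1 - u q.2) ^ 2 * (1 / (8 * K)) := by
        field_simp
        ring
      refine abs_le'.2 ⟨?_, ?_⟩
      · rw [e1, add_assoc]
        exact le_add_of_nonneg_right (by positivity)
      · rw [e2, add_assoc]
        exact le_add_of_nonneg_right (by positivity)
    calc _ ≤ R.adjWeight q * _ := mul_le_mul_of_nonneg_left h3 (R.adjWeight_nonneg q)
      _ = _ := by ring
  rw [Finset.sum_add_distrib, ← Finset.mul_sum, ← Finset.mul_sum, Finset.sum_add_distrib, hsq,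
    hsq'] at h2
  have h3 := h1.trans (mul_le_mul_of_nonneg_left h2 hK.le)
  have e : ∀ a b : ℝ, K * (2 * K * a + 1 / (4 * K) * (b + b)) = 2 * K ^ 2 * a + b / 2 := by
    intro a b
    field_simp
    ring
  rw [e] at h3
  linarith

theorem SimpleGraph.dirichlet_eq {X : Type*} {R : SimpleGraph X} {N : X → Finset X}
    (hN : ∀ x y, y ∈ N x ↔ R.Adj x y) {S B : Finset X} (hSB : S ⊆ B) (hB : ∀ x ∈ S, N x ⊆ B)
    (u : X → ℝ) (hu : ∀ x, x ∉ S → u x = 0) :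
    ∑ q ∈ B ×ˢ B, R.adjWeight q * (u q.1 - u q.2) ^ 2 =
      2 * ∑ x ∈ S, u x * ((N x).card * u x - ∑ y ∈ N x, u y) := by
  have h1 : ∑ q ∈ B ×ˢ B, R.adjWeight q * (u q.1 * (u q.1 - u q.2)) =
      ∑ x ∈ S, u x * ((N x).card * u x - ∑ y ∈ N x, u y) := by
    rw [Finset.sum_product, ← Finset.sum_subset hSB]
    · refine Finset.sum_congr rfl fun x hx => ?_
      rw [SimpleGraph.sum_adjWeight_left hN (hB x hx) (fun y => u x * (u x - u y)),
        ← Finset.mul_sum, Finset.sum_sub_distrib]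
      simp
    · intro x _ hx
      simp [hu x hx]
  rw [two_mul, ← h1]
  nth_rewrite 2 [← SimpleGraph.sum_adjWeight_swap]
  rw [← Finset.sum_add_distrib]
  exact Finset.sum_congr rfl fun q _ => by simp only [Prod.fst_swap, Prod.snd_swap]; ring

/-! ### The walk killed at its starting point -/

open Classical in
/-- `killedMass N o n x` is the probability that the walk from `o` is at `x` at time `n` and has
not returned to `o`. -/
def killedMass {X : Type*} (N : X → Finset X) (o : X) : ℕ → X → ℝ
  | 0 => fun x => if x = o then 1 else 0
  | n + 1 => fun y => if y = o then 0 else ∑ x ∈ N y, killedMass N o n x / (N x).card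

/-- The probability that the first return to `o` happens at time `n + 1`. -/
def firstReturn {X : Type*} (N : X → Finset X) (o : X) (n : ℕ) : ℝ :=
  ∑ x ∈ N o, killedMass N o n x / (N x).card

/-- The Green function of the killed walk up to time `n`. -/
def killedGreen {X : Type*} (N : X → Finset X) (o : X) (n : ℕ) (x : X) : ℝ :=
  (∑ k ∈ Finset.range (n + 1), killedMass N o k x) / (N x).card

theorem killedMass_nonneg {X : Type*} (N : X → Finset X) (o : X) (n : ℕ) (x : X) :
    0 ≤ killedMass N o n x := by
  induction n generalizing x with
  | zero => unfold killedMass; split_ifs <;> norm_num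
  | succ n ih =>
    unfold killedMass
    split_ifs
    · exact le_rfl
    · exact Finset.sum_nonneg fun y _ => div_nonneg (ih y) (Nat.cast_nonneg _)

theorem exists_support_killedMass {X : Type*} {R : SimpleGraph X} {N : X → Finset X}
    (hN : ∀ x y, y ∈ N x ↔ R.Adj x y) (o : X) (n : ℕ) :
    ∃ S : Finset X, o ∈ S ∧ ∀ k ≤ n, ∀ x, x ∉ S → killedMass N o k x = 0 := by
  classical
  induction n with
  | zero =>
    refine ⟨{o}, Finset.mem_singleton_self o, fun k hk x hx => ?_⟩
    rw [Nat.le_zero.1 hk]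
    simpa [killedMass] using hx
  | succ n ih =>
    obtain ⟨S, ho, hS⟩ := ih
    refine ⟨S ∪ S.biUnion N, Finset.mem_union_left _ ho, fun k hk x hx => ?_⟩
    rw [Finset.mem_union, not_or] at hx
    rcases Nat.lt_or_ge n k with h | h
    · obtain rfl : k = n + 1 := by omega
      unfold killedMass
      split_ifs
      · rfl
      · refine Finset.sum_eq_zero fun y hy => ?_
        rw [hS n le_rfl y, zero_div]
        intro hyS
        exact hx.2 (Finset.mem_biUnion.2 ⟨y, hyS, (hN y x).2 ((hN x y).1 hy).symm⟩)
    · exact hS k h x hx.1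

theorem killedGreen_self {X : Type*} (N : X → Finset X) (o : X) (n : ℕ) :
    killedGreen N o n o = 1 / (N o).card := by
  unfold killedGreen
  rw [Finset.sum_range_succ', Finset.sum_eq_zero fun k _ => by simp [killedMass]]
  simp [killedMass]

theorem sum_killedGreen {X : Type*} (N : X → Finset X) (o : X) (n : ℕ) :
    ∑ x ∈ N o, killedGreen N o n x = ∑ k ∈ Finset.range (n + 1), firstReturn N o k := by
  unfold firstReturn killedGreen
  rw [Finset.sum_comm]
  exact Finset.sum_congr rfl fun x _ => Finset.sum_div _ _ _

theorem sum_killedGreen_of_ne {X : Type*} (N : X → Finset X) {o x : X} (hx : x ≠ o)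
    (hd : (N x).Nonempty) (n : ℕ) :
    ∑ y ∈ N x, killedGreen N o n y = (N x).card * killedGreen N o (n + 1) x := by
  have hc : ((N x).card : ℝ) ≠ 0 := by exact_mod_cast hd.card_pos.ne'
  unfold killedGreen
  rw [mul_div_cancel₀ _ hc, Finset.sum_range_succ' _ (n + 1)]
  simp only [killedMass, hx, if_false, add_zero]
  rw [Finset.sum_comm]
  exact Finset.sum_congr rfl fun x _ => Finset.sum_div _ _ _

/-- The truncated Green function `u` has finite support. It is subharmonic on its support away from
`o`, since one more step only adds mass, while its Laplacian at `o` is `1 - ρ`. Its energy is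
therefore at most `2 * u o * (1 - ρ)`. Keeping only the term at `o` in the Poincaré inequality gives
`u o ≤ 8 * K ^ 2 * u o * (1 - ρ)`. -/
theorem sum_firstReturn_le {X : Type*} {R : SimpleGraph X} {N : X → Finset X}
    (hN : ∀ x y, y ∈ N x ↔ R.Adj x y) (hne : ∀ x, (N x).Nonempty) {K : ℝ} (hK : 0 < K)
    (hiso : ∀ D : Finset X, ∑ d ∈ D, ((N d).card : ℝ) ≤ K * ((R.outDarts D).ncard : ℝ))
    (o : X) (n : ℕ) :
    ∑ k ∈ Finset.range (n + 1), firstReturn N o k ≤ 1 - 1 / (8 * K ^ 2) := by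
  classical
  obtain ⟨S, ho, hS⟩ := exists_support_killedMass hN o n
  set u := killedGreen N o n with hu
  have hpos : ∀ x, 0 < ((N x).card : ℝ) := fun x => by exact_mod_cast (hne x).card_pos
  have huS : ∀ x, x ∉ S → u x = 0 := fun x hx => by
    rw [hu, killedGreen, Finset.sum_eq_zero fun k hk => hS k
      (Nat.lt_succ_iff.1 (Finset.mem_range.1 hk)) x hx, zero_div]
  have hu0 : ∀ x, 0 ≤ u x := fun x =>
    div_nonneg (Finset.sum_nonneg fun k _ => killedMass_nonneg N o k x) (Nat.cast_nonneg _)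
  have hSB : S ⊆ S ∪ S.biUnion N := Finset.subset_union_left
  have hB : ∀ x ∈ S, N x ⊆ S ∪ S.biUnion N := fun x hx =>
    (Finset.subset_biUnion_of_mem N hx).trans Finset.subset_union_right
  have hp := SimpleGraph.poincare hN hK hiso hSB hB u huS
  rw [SimpleGraph.dirichlet_eq hN hSB hB u huS] at hp
  have huo : u o = 1 / (N o).card := killedGreen_self N o n
  set ρ := ∑ k ∈ Finset.range (n + 1), firstReturn N o k with hρ
  have hsum : ∑ y ∈ N o, u y = ρ := sum_killedGreen N o n
  have hle : ∑ x ∈ S, u x * ((N x).card * u x - ∑ y ∈ N x, u y) ≤ u o * (1 - ρ) := by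
    rw [← Finset.add_sum_erase _ _ ho, hsum]
    have h1 : ((N o).card : ℝ) * u o = 1 := by
      rw [huo]
      exact mul_one_div_cancel (hpos o).ne'
    rw [h1]
    refine add_le_of_nonpos_right (Finset.sum_nonpos fun x hx => ?_)
    refine mul_nonpos_of_nonneg_of_nonpos (hu0 x) ?_
    rw [hu, sum_killedGreen_of_ne N (Finset.mem_erase.1 hx).1 (hne x), ← mul_sub]
    refine mul_nonpos_of_nonneg_of_nonpos (hpos x).le (sub_nonpos.2 ?_)
    refine div_le_div_of_nonneg_right ?_ (hpos x).le
    exact Finset.sum_le_sum_of_subset_of_nonneg (Finset.range_mono (by omega))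
      fun k _ _ => killedMass_nonneg N o k x
  have hge : ((N o).card : ℝ) * u o ^ 2 ≤ ∑ x ∈ S, ((N x).card : ℝ) * u x ^ 2 :=
    Finset.single_le_sum (f := fun x => ((N x).card : ℝ) * u x ^ 2)
      (fun x _ => mul_nonneg (hpos x).le (sq_nonneg _)) ho
  have h2 : ((N o).card : ℝ) * u o ^ 2 = u o := by
    rw [huo]
    field_simp [(hpos o).ne']
  have huo0 : 0 < u o := by rw [huo]; exact one_div_pos.2 (hpos o)
  have h3 : u o * 1 ≤ u o * (8 * K ^ 2 * (1 - ρ)) := by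
    calc u o * 1 ≤ 4 * K ^ 2 * (2 * ∑ x ∈ S, u x * ((N x).card * u x - ∑ y ∈ N x, u y)) := by
          rw [mul_one, ← h2]
          exact hge.trans hp
      _ ≤ 4 * K ^ 2 * (2 * (u o * (1 - ρ))) := by gcongr
      _ = _ := by ring
  have h4 := le_of_mul_le_mul_left h3 huo0
  have h5 : 1 / (8 * K ^ 2) ≤ 1 - ρ := by
    rw [div_le_iff₀ (by positivity)]
    linarith
  linarith

/-! ### The law of the walk -/

/-- The event that a trajectory does not revisit `o` at the times `1, …, n`. -/
def avoids {X : Type*} (o : X) (n : ℕ) : Set (ℕ → X) := {ω | ∀ k, 1 ≤ k → k ≤ n → ω k ≠ o}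

/-- As a function of the starting point `x`, this is a finite sum of indicators over the neighbours
of `y`, so it can be integrated termwise even if `X` is uncountable. -/
theorem stepMeasure_singleton {X : Type*} [MeasurableSpace X] [DiscreteMeasurableSpace X]
    {R : SimpleGraph X} {N : X → Finset X} (hN : ∀ x y, y ∈ N x ↔ R.Adj x y)
    (hne : ∀ x, (N x).Nonempty) (x y : X) :
    R.stepMeasure x {y} =
      ∑ z ∈ N y, ({z} : Set X).indicator (fun _ => ENNReal.ofReal (1 / (N z).card)) x := by
  classical
  have hs : R.neighborSet x = N x := by
    ext z
    simp [hN]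
  have hc : (R.neighborSet x).Finite ∧ (R.neighborSet x).Nonempty := by
    rw [hs]
    exact ⟨Finset.finite_toSet _, hne x⟩
  rw [SimpleGraph.stepMeasure, if_pos hc, hs, uniformOn, cond_apply (Finset.measurableSet _)]
  rw [Measure.count_apply_finset]
  simp only [Set.indicator_apply, Set.mem_singleton_iff]
  rw [Finset.sum_ite_eq]
  have hpos : (0 : ℝ) < (N x).card := by exact_mod_cast (hne x).card_pos
  by_cases hxy : R.Adj x y
  · rw [if_pos ((hN y x).2 hxy.symm), Set.inter_eq_right.2 (by simpa [hN] using hxy),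
      Measure.count_singleton, mul_one, one_div, ENNReal.ofReal_inv_of_pos hpos,
      ENNReal.ofReal_natCast]
  · rw [if_neg fun h => hxy ((hN y x).1 h).symm]
    have : (N x : Set X) ∩ {y} = ∅ := by
      rw [Set.inter_singleton_eq_empty]
      simpa [hN] using hxy
    rw [this, measure_empty, mul_zero]

theorem measurableSet_eval_eq {X ι : Type*} [MeasurableSpace X] [DiscreteMeasurableSpace X]
    (i : ι) (x : X) : MeasurableSet {ω : ι → X | ω i = x} :=
  measurableSet_preimage (f := fun ω : ι → X => ω i) (measurable_pi_apply i)
    (MeasurableSet.of_discrete (s := {x}))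

instance SimpleGraph.isProbabilityMeasure_walkLaw {X : Type*} [MeasurableSpace X]
    [DiscreteMeasurableSpace X] (R : SimpleGraph X) (o : X) : IsProbabilityMeasure (R.walkLaw o) := by
  unfold SimpleGraph.walkLaw
  infer_instance

theorem walkLaw_zero {X : Type*} [MeasurableSpace X] [DiscreteMeasurableSpace X]
    (R : SimpleGraph X) (o : X) : R.walkLaw o {ω | ω 0 = o} = 1 := by
  have hms : MeasurableSet {z : Finset.Iic 0 → X | z ⟨0, by simp⟩ = o} :=
    measurableSet_eval_eq _ o
  have hpre : {ω : ℕ → X | ω 0 = o} =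
      (Preorder.frestrictLe (π := fun _ => X) 0) ⁻¹' {z | z ⟨0, by simp⟩ = o} := rfl
  have hstart : Measure.map (MeasurableEquiv.piUnique fun _ : Finset.Iic 0 => X).symm
      (Measure.dirac o) = Measure.dirac fun _ => o :=
    Measure.map_dirac o
  have hlaw : R.walkLaw o = Kernel.traj (X := fun _ => X) R.stepKernel 0 fun _ => o := by
    refine Eq.trans ?_ (Measure.dirac_bind (Kernel.measurable _) _)
    exact congrArg (fun ν => Measure.bind ν (Kernel.traj (X := fun _ => X) R.stepKernel 0)) hstart
  rw [hlaw, hpre, ← Measure.map_apply (by fun_prop) hms,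
    ← Kernel.map_apply _ (by fun_prop), Kernel.traj_map_frestrictLe_of_le le_rfl,
    Kernel.deterministic_apply, Measure.dirac_apply' _ hms]
  exact Set.indicator_of_mem (s := {z : Finset.Iic 0 → X | z ⟨0, by simp⟩ = o}) rfl _

/-- This is the Markov property at time `n`: avoidance is an event of the trajectory up to `n`,
whose joint law with the next position is a composition product with the step kernel. -/
theorem walkLaw_step {X : Type*} [MeasurableSpace X] [DiscreteMeasurableSpace X]
    {R : SimpleGraph X} {N : X → Finset X} (hN : ∀ x y, y ∈ N x ↔ R.Adj x y)
    (hne : ∀ x, (N x).Nonempty) (o : X) (n : ℕ) (y : X) :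
    R.walkLaw o (avoids o n ∩ {ω | ω (n + 1) = y}) =
      ∑ x ∈ N y, ENNReal.ofReal (1 / (N x).card) * R.walkLaw o (avoids o n ∩ {ω | ω n = x}) := by
  classical
  set μ := R.walkLaw o with hμ
  have hμ' : μ.map (Preorder.frestrictLe (π := fun _ => X) n) ⊗ₘ R.stepKernel n =
      μ.map (fun ω => (Preorder.frestrictLe (π := fun _ => X) n ω, ω (n + 1))) :=
    Kernel.map_frestrictLe_trajMeasure_compProd_eq_map_trajMeasure
  have : IsProbabilityMeasure (μ.map (Preorder.frestrictLe (π := fun _ => X) n)) :=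
    Measure.isProbabilityMeasure_map (by fun_prop)
  set A : Set (Finset.Iic n → X) := ⋂ k : Finset.Iic n, {z | 1 ≤ (k : ℕ) → z k ≠ o} with hA
  have hAm : MeasurableSet A := by
    refine MeasurableSet.iInter fun k => ?_
    by_cases hk : 1 ≤ (k : ℕ)
    · simpa only [hk, true_imp_iff] using! (measurableSet_eval_eq k o).compl
    · simp [hk]
  have hpre : avoids o n = (Preorder.frestrictLe (π := fun _ => X) n) ⁻¹' A := by
    ext ω
    simp only [avoids, hA, Set.mem_ofPred_eq, Set.mem_preimage, Set.mem_iInter, Subtype.forall,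
      Finset.mem_Iic]
    exact ⟨fun h k hk hk' => h k hk' hk, fun h k hk hk' => h k hk' hk⟩
  have h1 : avoids o n ∩ {ω | ω (n + 1) = y} =
      (fun ω => (Preorder.frestrictLe (π := fun _ => X) n ω, ω (n + 1))) ⁻¹' (A ×ˢ {y}) := by
    rw [hpre]; rfl
  have h2 : ∀ x, avoids o n ∩ {ω | ω n = x} = (Preorder.frestrictLe (π := fun _ => X) n) ⁻¹'
      ({z | z ⟨n, Finset.mem_Iic.2 le_rfl⟩ = x} ∩ A) := by
    intro x
    rw [hpre, Set.inter_comm]; rfl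
  rw [h1, ← Measure.map_apply (by fun_prop) (hAm.prod MeasurableSet.of_discrete), ← hμ',
    Measure.compProd_apply_prod hAm MeasurableSet.of_discrete]
  have h3 : ∀ z : Finset.Iic n → X, R.stepKernel n z {y} = ∑ x ∈ N y,
      {z : Finset.Iic n → X | z ⟨n, Finset.mem_Iic.2 le_rfl⟩ = x}.indicator
        (fun _ => ENNReal.ofReal (1 / (N x).card)) z := fun z =>
    stepMeasure_singleton hN hne _ y
  simp only [h3]
  rw [lintegral_finsetSum _ fun x _ => measurable_const.indicator (measurableSet_eval_eq _ x)]
  refine Finset.sum_congr rfl fun x _ => ?_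
  rw [lintegral_indicator_const (measurableSet_eval_eq _ x),
    Measure.restrict_apply (measurableSet_eval_eq _ x),
    Measure.map_apply (by fun_prop) ((measurableSet_eval_eq _ x).inter hAm), h2]

theorem walkLaw_avoids {X : Type*} [MeasurableSpace X] [DiscreteMeasurableSpace X]
    {R : SimpleGraph X} {N : X → Finset X} (hN : ∀ x y, y ∈ N x ↔ R.Adj x y)
    (hne : ∀ x, (N x).Nonempty) (o : X) (n : ℕ) (x : X) :
    R.walkLaw o (avoids o n ∩ {ω | ω n = x}) = ENNReal.ofReal (killedMass N o n x) := by
  induction n generalizing x with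
  | zero =>
    have h0 : avoids o 0 = Set.univ := by
      ext ω
      simp only [avoids, Set.mem_ofPred_eq, Set.mem_univ, iff_true]
      intro k hk hk'
      omega
    rw [h0, Set.univ_inter]
    by_cases hx : x = o
    · subst hx
      simp [killedMass, walkLaw_zero]
    · have hsub : {ω : ℕ → X | ω 0 = x} ⊆ {ω | ω 0 = o}ᶜ := fun ω h h' => hx (h.symm.trans h')
      have hz := (prob_compl_eq_zero_iff (measurableSet_eval_eq 0 o)).2 (walkLaw_zero R o)
      simp [killedMass, hx, measure_mono_null hsub hz]
  | succ n ih =>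
    by_cases hx : x = o
    · have : avoids o (n + 1) ∩ {ω | ω (n + 1) = x} = ∅ := by
        ext ω
        simp only [Set.mem_inter_iff, Set.mem_empty_iff_false, iff_false, not_and]
        intro h h'
        exact h (n + 1) (by omega) le_rfl (h'.trans hx)
      rw [this, measure_empty]
      simp [killedMass, hx]
    · have : avoids o (n + 1) ∩ {ω | ω (n + 1) = x} = avoids o n ∩ {ω | ω (n + 1) = x} := by
        ext ω
        simp only [avoids, Set.mem_inter_iff, Set.mem_ofPred_eq, and_congr_left_iff]
        intro h
        refine ⟨fun h' k hk hk' => h' k hk (by omega), fun h' k hk hk' => ?_⟩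
        rcases Nat.lt_or_ge n k with hkn | hkn
        · obtain rfl : k = n + 1 := by omega
          exact fun h'' => hx (h.symm.trans h'')
        · exact h' k hk hkn
      rw [this, walkLaw_step hN hne]
      simp only [killedMass, hx, if_false]
      rw [ENNReal.ofReal_sum_of_nonneg fun y _ =>
        div_nonneg (killedMass_nonneg N o n y) (Nat.cast_nonneg _)]
      refine Finset.sum_congr rfl fun y _ => ?_
      rw [ih, ← ENNReal.ofReal_mul (by positivity), one_div_mul_eq_div]

theorem walkLaw_firstReturn {X : Type*} [MeasurableSpace X] [DiscreteMeasurableSpace X]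
    {R : SimpleGraph X} {N : X → Finset X} (hN : ∀ x y, y ∈ N x ↔ R.Adj x y)
    (hne : ∀ x, (N x).Nonempty) (o : X) (n : ℕ) :
    R.walkLaw o (avoids o n ∩ {ω | ω (n + 1) = o}) = ENNReal.ofReal (firstReturn N o n) := by
  rw [walkLaw_step hN hne, firstReturn, ENNReal.ofReal_sum_of_nonneg fun y _ =>
    div_nonneg (killedMass_nonneg N o n y) (Nat.cast_nonneg _)]
  refine Finset.sum_congr rfl fun y _ => ?_
  rw [walkLaw_avoids hN hne, ← ENNReal.ofReal_mul (by positivity), one_div_mul_eq_div]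

/-- A locally finite graph without isolated vertices that satisfies a strong isoperimetric
inequality is transient. -/
theorem SimpleGraph.isTransient_of_isoperimetric {X : Type*} {R : SimpleGraph X}
    (hfin : ∀ x, (R.neighborSet x).Finite) (hne : ∀ x, (R.neighborSet x).Nonempty) {K : ℝ}
    (hK : 0 < K) (hiso : ∀ D : Finset X, ∑ d ∈ D, ((R.neighborSet d).ncard : ℝ) ≤
      K * ((R.outDarts D).ncard : ℝ)) :
    R.IsTransient := by
  intro o
  set N : X → Finset X := fun x => (hfin x).toFinset with hNdef
  have hN : ∀ x y, y ∈ N x ↔ R.Adj x y := fun x y => by simp [hNdef]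
  have hNne : ∀ x, (N x).Nonempty := fun x => by simpa [hNdef] using hne x
  have hcard : ∀ x, (R.neighborSet x).ncard = (N x).card := fun x =>
    Set.ncard_eq_toFinset_card _ (hfin x)
  simp only [hcard] at hiso
  unfold SimpleGraph.returnProb
  let _ : MeasurableSpace X := ⊤
  have : DiscreteMeasurableSpace X := ⟨fun _ => trivial⟩
  change R.walkLaw o {ω | ∃ n, 1 ≤ n ∧ ω n = o} < 1
  -- Decomposition by the first return time `n + 1`; an upper bound is wanted, so subadditivity
  -- suffices.
  have hsub : {ω : ℕ → X | ∃ n, 1 ≤ n ∧ ω n = o} ⊆ ⋃ n, avoids o n ∩ {ω | ω (n + 1) = o} := by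
    classical
    rintro ω h
    obtain ⟨h1, h2⟩ := Nat.find_spec h
    obtain ⟨m, hm⟩ : ∃ m, Nat.find h = m + 1 := ⟨Nat.find h - 1, by omega⟩
    refine Set.mem_iUnion.2 ⟨m, fun k hk hk' hko => ?_, by rw [hm] at h2; exact h2⟩
    exact Nat.find_min h (m := k) (by omega) ⟨hk, hko⟩
  have hr0 : ∀ n, 0 ≤ firstReturn N o n := fun n =>
    Finset.sum_nonneg fun y _ => div_nonneg (killedMass_nonneg N o n y) (Nat.cast_nonneg _)
  calc R.walkLaw o {ω | ∃ n, 1 ≤ n ∧ ω n = o}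
      ≤ ∑' n, R.walkLaw o (avoids o n ∩ {ω | ω (n + 1) = o}) :=
        (measure_mono hsub).trans (measure_iUnion_le _)
    _ = ∑' n, ENNReal.ofReal (firstReturn N o n) := by
        simp only [walkLaw_firstReturn hN hNne]
    _ ≤ ENNReal.ofReal (1 - 1 / (8 * K ^ 2)) := by
        rw [ENNReal.tsum_eq_iSup_nat]
        refine iSup_le fun n => ?_
        rw [← ENNReal.ofReal_sum_of_nonneg fun k _ => hr0 k]
        refine ENNReal.ofReal_le_ofReal (le_trans ?_ (sum_firstReturn_le hN hNne hK hiso o n))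
        exact Finset.sum_le_sum_of_subset_of_nonneg (Finset.range_mono (by omega))
          fun k _ _ => hr0 k
    _ < 1 := by
        rw [ENNReal.ofReal_lt_one]
        have : 0 < 1 / (8 * K ^ 2) := by positivity
        linarith

end

theorem theorem1p3 {V : Type*} (G : PlanarMap V)
    (hfin : ∀ v : V, (G.graph.neighborSet v).Finite)
    (hna : G.graph.IsNonamenable) :
    G.IsUKTransient := by
  obtain ⟨K, hK, hiso⟩ := G.roundabout_isoperimetric hfin hna
  exact SimpleGraph.isTransient_of_isoperimetric
    (fun d => (G.ncard_neighborSet_roundabout_le hfin d).1)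
    (fun d => ⟨d.symm, Or.inl rfl⟩) hK hiso
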